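/- Let $d\ge 2$ be an integer and $\alpha\in(0,d)$. For $F=(F_1,\dots,F_d)\in L^1(\mathbb{R}^d;\mathbb{R}^d)$ let $I_\alpha F=(I_\alpha F_1,\dots,I_\alpha F_d)$ be its Riesz potential, where $$I_\alpha f(x)=\frac1{\gamma(\alpha)}\int_{\mathbb{R}^d}\frac{f(y)}{|x-y|^{d-\alpha}}\,dy,\qquad \gamma(\alpha)=\frac{\pi^{d/2}2^{\alpha}\,\Gamma(\alpha/2)}{\Gamma((d-\alpha)/2)}.$$ For a measurable function $g:\mathbb{R}^d\to\mathbb{R}^d$ let $g^*(t)=\inf\{y\ge 0: |\{x : |g(x)|>y\}|<t\}$ $(t>0)$ be the left-continuous non-increasing rearrangement of its Euclidean norm, let $g^{**}(t)=\frac1t\int_0^t g^*(s)\,ds$, and for $1<q<\infty$ let $$\|g\|_{L^{q,1}(\mathbb{R}^d;\mathbb{R}^d)}=\int_0^\infty t^{1/q}g^{**}(t)\,\frac{dt}{t};$$ $L^{q,1}(\mathbb{R}^d;\mathbb{R}^d)$ is the space of measurable $g$ for which this is finite. Then there exists a constant $C=C(\alpha,d)>0$ such that for every $F\in L^1(\mathbb{R}^d;\mathbb{R}^d)$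 with $\operatorname{curl}F=0$ in the sense of distributions, that is, $\int_{\mathbb{R}^d} F_i\,\partial_j\varphi\,dx=\int_{\mathbb{R}^d} F_j\,\partial_i\varphi\,dx$ for all $i,j$ and all $\varphi\in C_c^\infty(\mathbb{R}^d)$, the integrals defining $I_\alpha F(x)$ converge absolutely for almost every $x$, $I_\alpha F\in L^{d/(d-\alpha),1}(\mathbb{R}^d;\mathbb{R}^d)$, and $$\|I_\alpha F\|_{L^{d/(d-\alpha),1}(\mathbb{R}^d;\mathbb{R}^d)}\le C\,\|F\|_{L^1(\mathbb{R}^d;\mathbb{R}^d)}.$$ -/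

import Mathlib

open MeasureTheory Set
open scoped ENNReal NNReal ContDiff

noncomputable section

/-- The normalization constant `γ(α) = π^{d/2} 2^α Γ(α/2) / Γ((d-α)/2)` of the Riesz potential
on `ℝ^d`. -/
def rieszConst (d : ℕ) (α : ℝ) : ℝ :=
  Real.pi ^ ((d : ℝ) / 2) * 2 ^ α * Real.Gamma (α / 2) / Real.Gamma (((d : ℝ) - α) / 2)

/-- The integrand `y ↦ f(y) / |x-y|^{d-α}` of the Riesz potential at the point `x`. -/
def rieszIntegrand {d : ℕ} (α : ℝ) (f : EuclideanSpace ℝ (Fin d) → ℝ)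
    (x y : EuclideanSpace ℝ (Fin d)) : ℝ :=
  f y / ‖x - y‖ ^ ((d : ℝ) - α)

/-- The Riesz potential `I_α f` of a scalar function. -/
def rieszPotential {d : ℕ} (α : ℝ) (f : EuclideanSpace ℝ (Fin d) → ℝ)
    (x : EuclideanSpace ℝ (Fin d)) : ℝ :=
  1 / rieszConst d α * ∫ y, rieszIntegrand α f x y

/-- The Riesz potential of a vector field, acting on components. -/
def rieszPotentialVec {d : ℕ} (α : ℝ)
    (F : EuclideanSpace ℝ (Fin d) → EuclideanSpace ℝ (Fin d))
    (x : EuclideanSpace ℝ (Fin d)) : EuclideanSpace ℝ (Fin d) :=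
  WithLp.toLp 2 fun i => rieszPotential α (fun y => F y i) x

/-- `curl F = 0` in the sense of distributions, that is, `∂_j F_i = ∂_i F_j` for all `i`, `j`,
tested against smooth compactly supported functions. -/
def CurlFree {d : ℕ} (F : EuclideanSpace ℝ (Fin d) → EuclideanSpace ℝ (Fin d)) : Prop :=
  ∀ i j : Fin d, ∀ φ : EuclideanSpace ℝ (Fin d) → ℝ, ContDiff ℝ ∞ φ → HasCompactSupport φ →
    ∫ x, F x i * fderiv ℝ φ x (EuclideanSpace.single j 1) =
      ∫ x, F x j * fderiv ℝ φ x (EuclideanSpace.single i 1)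

/-- The distribution function `m(f,y) = |{|f| > y}|`; for vector-valued `f`, `|f|` is its norm. -/
def distribFun {d : ℕ} {E : Type*} [NormedAddCommGroup E]
    (f : EuclideanSpace ℝ (Fin d) → E) (y : ℝ≥0) : ℝ≥0∞ :=
  volume {x | y < ‖f x‖₊}

/-- The non-increasing rearrangement `f^*`, the left-continuous inverse of `m(f,·)`:
`f^*(t) = inf {y ≥ 0 : m(f,y) < t}` for `t > 0` (`= ∞` if there is no such `y`). -/
def rearrangement {d : ℕ} {E : Type*} [NormedAddCommGroup E]
    (f : EuclideanSpace ℝ (Fin d) → E) (t : ℝ) : ℝ≥0∞ :=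
  ⨅ (y : ℝ≥0) (_ : distribFun f y < ENNReal.ofReal t), (y : ℝ≥0∞)

/-- `f^{**}(t) = (1/t) ∫_0^t f^*(s) ds` for `t > 0`. -/
def maximalRearrangement {d : ℕ} {E : Type*} [NormedAddCommGroup E]
    (f : EuclideanSpace ℝ (Fin d) → E) (t : ℝ) : ℝ≥0∞ :=
  (∫⁻ s in Ioc 0 t, rearrangement f s) / ENNReal.ofReal t

/-- The Lorentz norm `(∫_0^∞ (t^{1/q} f^{**}(t))^r dt/t)^{1/r}`, for `1 < q < ∞`, `1 ≤ r < ∞`. -/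
def lorentzNorm {d : ℕ} {E : Type*} [NormedAddCommGroup E] (q r : ℝ)
    (f : EuclideanSpace ℝ (Fin d) → E) : ℝ≥0∞ :=
  (∫⁻ t in Ioi (0 : ℝ),
    (ENNReal.ofReal (t ^ (1 / q)) * maximalRearrangement f t) ^ r / ENNReal.ofReal t) ^ (1 / r)

/-- Membership in the Lorentz space `L^{q,r}(ℝ^d; E)`. -/
def MemLorentz {d : ℕ} {E : Type*} [NormedAddCommGroup E] (q r : ℝ)
    (f : EuclideanSpace ℝ (Fin d) → E) : Prop :=
  AEStronglyMeasurable f volume ∧ lorentzNorm q r f < ⊤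

end

/-! ### Rearrangements and Lorentz norms -/

section Lorentz

variable {d : ℕ} {G : Type*} [NormedAddCommGroup G]

/-! For a general integrable field the Riesz potential lies only in weak `L^{d/(d-α)}`. The gain to
the second index `1` comes from moving a derivative onto the kernel, which is possible when the
field is a gradient.

How the norm is controlled. Put `μ = α/d`, so that `1/q = 1 - μ`. A function with `‖g‖₁ ≤ A` and
`‖g‖_∞ ≤ B` has `L^{q,1}` norm at most a constant times `A^{1-μ} B^μ`. If `|f|` is dominated by a
countable sum of such functions, the bounds add up, because `∫_0^t f^*` is controlled by the
`K`-functional of `(L¹, L^∞)` at `t`. This is `AtomicBound.lorentzNorm_le`; the rest of the proof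
produces an `AtomicBound`.

One scale (`exists_atomicBound_of_scale`). Let `‖∇v‖₁ ≤ N`, `‖v‖_∞ ≤ N ρ^{1-d}` and `‖v‖₁ ≤ N ρ`.
Cut `|x|^{α-d}` into smooth pieces `K_j` living at scale `s = 2^j`. Young's inequality gives `‖K_j *
∇v‖₁ ≲ s^α N`. Since `K_j * ∇v = ∇K_j * v`, the sup norm is at most a constant times both `s^{α-1} N
ρ^{1-d}` and `s^{α-d-1} N ρ`. Interpolation leaves `N min((s/ρ)^{α-μ}, (s/ρ)^{-μ})`, a two-sided
geometric series in `j`; `α > μ` because `d ≥ 2`.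

Gradients (`exists_atomicBound_gradient`). Cut the values of `u ∈ C¹_c` dyadically, `u = ∑ v_m` with
`v_m` of height about `a_m` and supported in `{|u| ≥ a_m}`. The numbers `‖∇v_m‖₁` sum to `‖∇u‖₁`. On
that support the preceding piece is at least `a_m/4`, so Gagliardo–Nirenberg–Sobolev bounds the
support by the gradient mass of `v_{m-1}`. Each `v_m` is therefore adapted to a single scale, with
`N` comparable to `‖∇v_m‖₁ + ‖∇v_{m-1}‖₁` plus a geometric error.

Curl-free fields (`CurlFree.exists_lintegral_sub_gradient_le`). Such an `F` has integral zero.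
Convolving `F` with the divergence of a test field gives a gradient, and the difference of a narrow
and a wide approximate identity is such a divergence. The narrow one reproduces `F`, the wide one
tends to zero in `L¹`, and a cutoff makes the potential compactly supported. `F` then becomes a
rapidly converging telescoping series of gradients, to which the previous bound applies term by
term. -/

theorem antitone_distribFun (f : EuclideanSpace ℝ (Fin d) → G) : Antitone (distribFun f) :=
  fun _ _ h => measure_mono fun _ hx => lt_of_le_of_lt h hx

/-- Every height `c + y` below `f^*(s)` satisfies `m(f, c + y) ≥ s`, so the excess of `f^*(s)` over
`c` is at most the length of the set of such `y`. This turns the rearrangement into a layer-cake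
integral suited to Tonelli. -/
theorem rearrangement_le_add_lintegral (f : EuclideanSpace ℝ (Fin d) → G) (c : ℝ≥0) (s : ℝ) :
    rearrangement f s ≤ c + ∫⁻ y in Ioi (0 : ℝ),
      {y : ℝ | ENNReal.ofReal s ≤ distribFun f (c + y.toNNReal)}.indicator 1 y := by
  by_contra! hlt
  obtain ⟨r, hr1, hr2⟩ := ENNReal.lt_iff_exists_nnreal_btwn.1 hlt
  have hcr : c ≤ r := by
    have : (c : ℝ≥0∞) ≤ r := le_self_add.trans hr1.le
    exact_mod_cast this
  have key : ((r - c : ℝ≥0) : ℝ≥0∞) ≤ ∫⁻ y in Ioi (0 : ℝ),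
      {y : ℝ | ENNReal.ofReal s ≤ distribFun f (c + y.toNNReal)}.indicator 1 y := by
    calc ((r - c : ℝ≥0) : ℝ≥0∞) = ∫⁻ y in Ioo (0 : ℝ) ((r - c : ℝ≥0) : ℝ), 1 := by
          simp
      _ ≤ ∫⁻ y in Ioo (0 : ℝ) ((r - c : ℝ≥0) : ℝ),
          {y : ℝ | ENNReal.ofReal s ≤ distribFun f (c + y.toNNReal)}.indicator 1 y := by
          refine setLIntegral_mono' measurableSet_Ioo fun y hy => ?_
          have : ENNReal.ofReal s ≤ distribFun f (c + y.toNNReal) := by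
            by_contra! h
            have h1 : rearrangement f s ≤ ((c + y.toNNReal : ℝ≥0) : ℝ≥0∞) := iInf₂_le (f := fun (y : ℝ≥0) (_ : distribFun f y < ENNReal.ofReal s) => (y : ℝ≥0∞)) _ h
            have h2 : c + y.toNNReal ≤ r := by
              have h3 : (y.toNNReal : ℝ) = y := Real.coe_toNNReal _ hy.1.le
              have h4 := hy.2
              rw [NNReal.coe_sub hcr] at h4
              rw [← NNReal.coe_le_coe]; push_cast; linarith
            exact absurd (hr2.trans_le h1) (not_lt.2 (by exact_mod_cast h2))
          simp [this]
      _ ≤ _ := lintegral_mono_set Ioo_subset_Ioi_self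
  have : (r : ℝ≥0∞) ≤ c + ∫⁻ y in Ioi (0 : ℝ),
      {y : ℝ | ENNReal.ofReal s ≤ distribFun f (c + y.toNNReal)}.indicator 1 y := by
    calc (r : ℝ≥0∞) = c + ((r - c : ℝ≥0) : ℝ≥0∞) := by
          rw [← ENNReal.coe_add, add_tsub_cancel_of_le hcr]
      _ ≤ _ := by gcongr
  exact absurd hr1 (not_lt.2 this)

theorem volume_Ioi_inter_ofReal_le (m : ℝ≥0∞) :
    volume (Ioi (0 : ℝ) ∩ {s | ENNReal.ofReal s ≤ m}) ≤ m := by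
  rcases eq_or_ne m ⊤ with rfl | hm
  · exact le_top
  · calc volume (Ioi (0 : ℝ) ∩ {s | ENNReal.ofReal s ≤ m}) ≤ volume (Ioc 0 m.toReal) := by
          refine measure_mono fun s hs => ⟨hs.1, ?_⟩
          exact (ENNReal.ofReal_le_iff_le_toReal hm).1 hs.2
      _ = m := by simp [ENNReal.ofReal_toReal hm]

/-- The integral of the rearrangement over `(0, t)` is at most the `K`-functional between
`L¹` and `L^∞`, evaluated at a truncation. -/
theorem lintegral_rearrangement_le {f : EuclideanSpace ℝ (Fin d) → G}
    (hf : AEMeasurable (fun x => ‖f x‖)) (c : ℝ≥0) (t : ℝ) :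
    ∫⁻ s in Ioc 0 t, rearrangement f s ≤ ENNReal.ofReal t * c + ∫⁻ x, (‖f x‖ₑ - c) := by
  have hm : Measurable fun y : ℝ => distribFun f (c + y.toNNReal) :=
    ((antitone_distribFun f).comp_monotone
      fun a b h => by gcongr).measurable
  have hmeas : MeasurableSet {p : ℝ × ℝ | ENNReal.ofReal p.1 ≤ distribFun f (c + p.2.toNNReal)} :=
    measurableSet_le (by fun_prop) (hm.comp measurable_snd)
  have hcake : ∫⁻ x, (‖f x‖ₑ - c) = ∫⁻ y in Ioi (0 : ℝ), distribFun f (c + y.toNNReal) := by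
    have h1 : ∫⁻ x, (‖f x‖ₑ - c) = ∫⁻ x, ENNReal.ofReal (max (‖f x‖ - c) 0) := by
      refine lintegral_congr fun x => ?_
      rw [ENNReal.ofReal_max, ENNReal.ofReal_sub _ (NNReal.coe_nonneg c), ofReal_norm]
      simp
    rw [h1, lintegral_eq_lintegral_meas_lt]
    · refine setLIntegral_congr_fun measurableSet_Ioi fun y hy => ?_
      simp only [distribFun]
      congr 1
      ext x
      have hy' : (0 : ℝ) < y := hy
      simp only [mem_ofPred_eq, lt_max_iff, ← NNReal.coe_lt_coe, NNReal.coe_add,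
        Real.coe_toNNReal _ hy'.le, coe_nnnorm]
      constructor
      · rintro (h | h) <;> linarith
      · intro h; left; linarith
    · exact Filter.Eventually.of_forall fun x => le_max_right _ _
    · exact (hf.sub_const _).max aemeasurable_const
  calc ∫⁻ s in Ioc 0 t, rearrangement f s
      ≤ ∫⁻ s in Ioc 0 t, (c + ∫⁻ y in Ioi (0 : ℝ),
          {y : ℝ | ENNReal.ofReal s ≤ distribFun f (c + y.toNNReal)}.indicator 1 y) :=
        lintegral_mono fun s => rearrangement_le_add_lintegral f c s
    _ = ENNReal.ofReal t * c + ∫⁻ s in Ioc 0 t, ∫⁻ y in Ioi (0 : ℝ),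
          {y : ℝ | ENNReal.ofReal s ≤ distribFun f (c + y.toNNReal)}.indicator 1 y := by
        rw [lintegral_add_left measurable_const]
        simp [mul_comm]
    -- Enlarging `(0, t]` to `(0, ∞)` is harmless: after the swap, the admissible `s` for fixed `y`
    -- have total length at most `m(f, c + y)`.
    _ ≤ ENNReal.ofReal t * c + ∫⁻ s in Ioi (0 : ℝ), ∫⁻ y in Ioi (0 : ℝ),
          {p : ℝ × ℝ | ENNReal.ofReal p.1 ≤ distribFun f (c + p.2.toNNReal)}.indicator 1 (s, y) := by
        gcongr
        · exact Ioc_subset_Ioi_self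
        · rfl
    _ = ENNReal.ofReal t * c + ∫⁻ y in Ioi (0 : ℝ), ∫⁻ s in Ioi (0 : ℝ),
          {p : ℝ × ℝ | ENNReal.ofReal p.1 ≤ distribFun f (c + p.2.toNNReal)}.indicator 1 (s, y) := by
        rw [lintegral_lintegral_swap]
        exact (measurable_one.indicator hmeas).aemeasurable
    _ ≤ ENNReal.ofReal t * c + ∫⁻ y in Ioi (0 : ℝ), distribFun f (c + y.toNNReal) := by
        gcongr with y
        have : ∀ s : ℝ,
            {p : ℝ × ℝ | ENNReal.ofReal p.1 ≤ distribFun f (c + p.2.toNNReal)}.indicator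
              (1 : ℝ × ℝ → ℝ≥0∞) (s, y) =
            {s : ℝ | ENNReal.ofReal s ≤ distribFun f (c + y.toNNReal)}.indicator 1 s :=
          fun s => rfl
        simp_rw [this]
        rw [lintegral_indicator_one (measurableSet_le (by fun_prop) measurable_const),
          Measure.restrict_apply (measurableSet_le (by fun_prop) measurable_const), inter_comm]
        exact volume_Ioi_inter_ofReal_le _
    _ = _ := by rw [hcake]

/-- `f` is dominated by a countable sum of functions `g i` with `‖g i‖₁ ≤ A i`, `‖g i‖_∞ ≤ B i` and
`∑ A i ^ (1 - μ) * B i ^ μ ≤ M`. -/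
def AtomicBound {Ω : Type*} [MeasureSpace Ω] {G : Type*} [NormedAddCommGroup G] (μ : ℝ)
    (f : Ω → G) (M : ℝ≥0∞) : Prop :=
  ∃ (ι : Type) (_ : Countable ι) (g : ι → Ω → ℝ≥0∞) (A B : ι → ℝ),
    (∀ i, AEMeasurable (g i)) ∧ (∀ i, 0 < A i) ∧ (∀ i, 0 < B i) ∧
    (∀ i, ∫⁻ x, g i x ≤ ENNReal.ofReal (A i)) ∧
    (∀ i, ∀ᵐ x, g i x ≤ ENNReal.ofReal (B i)) ∧
    (∀ᵐ x, ‖f x‖ₑ ≤ ∑' i, g i x) ∧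
    ∑' i, ENNReal.ofReal (A i ^ (1 - μ) * B i ^ μ) ≤ M

theorem AtomicBound.mono {Ω : Type*} [MeasureSpace Ω] {μ : ℝ} {f : Ω → G} {M M' : ℝ≥0∞}
    (h : AtomicBound μ f M) (hM : M ≤ M') : AtomicBound μ f M' := by
  obtain ⟨ι, hι, g, A, B, h1, h2, h3, h4, h5, h6, h7⟩ := h
  exact ⟨ι, hι, g, A, B, h1, h2, h3, h4, h5, h6, h7.trans hM⟩

theorem AtomicBound.of_ae_eq_zero {Ω : Type*} [MeasureSpace Ω] {μ : ℝ} {f : Ω → G} {M : ℝ≥0∞}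
    (h : f =ᵐ[volume] 0) : AtomicBound μ f M := by
  refine ⟨Empty, inferInstance, fun _ _ => 0, fun _ => 1, fun _ => 1, by simp, by simp, by simp,
    by simp, by simp, ?_, by simp⟩
  filter_upwards [h] with x hx
  simp [hx]

/-- The families of atoms are merged over a sigma type. This replaces the triangle inequality for
the Lorentz norm. -/
theorem AtomicBound.tsum {Ω : Type*} [MeasureSpace Ω] {μ : ℝ} {κ : Type} [Countable κ]
    {f : Ω → G} {F : κ → Ω → G} {M : κ → ℝ≥0∞} (h : ∀ k, AtomicBound μ (F k) (M k))
    (hf : ∀ᵐ x, ‖f x‖ₑ ≤ ∑' k, ‖F k x‖ₑ) : AtomicBound μ f (∑' k, M k) := by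
  choose ι hι g A B h1 h2 h3 h4 h5 h6 h7 using h
  refine ⟨Σ k, ι k, inferInstance, fun i => g i.1 i.2, fun i => A i.1 i.2, fun i => B i.1 i.2,
    fun i => h1 _ _, fun i => h2 _ _, fun i => h3 _ _, fun i => h4 _ _, fun i => h5 _ _, ?_, ?_⟩
  · filter_upwards [hf, ae_all_iff.2 h6] with x hx hx'
    rw [ENNReal.tsum_sigma (f := fun k i => g k i x)]
    exact hx.trans (ENNReal.tsum_le_tsum hx')
  · rw [ENNReal.tsum_sigma (f := fun k i => ENNReal.ofReal (A k i ^ (1 - μ) * B k i ^ μ))]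
    exact ENNReal.tsum_le_tsum h7

/-- The Lorentz norm of a single atom. -/
theorem lintegral_rpow_mul_min_le {μ A B : ℝ} (hμ0 : 0 < μ) (hμ1 : μ < 1) (hA : 0 < A)
    (hB : 0 < B) :
    ∫⁻ t in Ioi (0 : ℝ), ENNReal.ofReal (t ^ (-1 - μ)) *
        min (ENNReal.ofReal A) (ENNReal.ofReal t * ENNReal.ofReal B) ≤
      ENNReal.ofReal ((1 / (1 - μ) + 1 / μ)) * ENNReal.ofReal (A ^ (1 - μ) * B ^ μ) := by
  -- The two terms of the minimum cross at `t = A / B`.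
  set t₀ := A / B with ht₀
  have ht : 0 < t₀ := by positivity
  rw [← Ioc_union_Ioi_eq_Ioi ht.le]
  refine (lintegral_union_le _ _ _).trans ?_
  have h1 : ∫⁻ t in Ioc 0 t₀, ENNReal.ofReal (t ^ (-1 - μ)) *
        min (ENNReal.ofReal A) (ENNReal.ofReal t * ENNReal.ofReal B) ≤
      ENNReal.ofReal (B * (t₀ ^ (1 - μ) / (1 - μ))) := by
    have hint : IntervalIntegrable (fun t : ℝ => t ^ (-μ)) volume 0 t₀ :=
      intervalIntegral.intervalIntegrable_rpow' (by linarith)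
    have hi : ∫ t in (0 : ℝ)..t₀, t ^ (-μ) = t₀ ^ (1 - μ) / (1 - μ) := by
      rw [integral_rpow (Or.inl (by linarith)), Real.zero_rpow (by linarith)]
      rw [show -μ + 1 = 1 - μ by ring, sub_zero]
    calc _ ≤ ∫⁻ t in Ioc 0 t₀, ENNReal.ofReal B * ENNReal.ofReal (t ^ (-μ)) := by
          refine setLIntegral_mono' measurableSet_Ioc fun t ht => ?_
          calc _ ≤ ENNReal.ofReal (t ^ (-1 - μ)) * (ENNReal.ofReal t * ENNReal.ofReal B) := by
                gcongr; exact min_le_right _ _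
            _ = _ := by
                have h0 : (0 : ℝ) < t := ht.1
                rw [← ENNReal.ofReal_mul h0.le, ← ENNReal.ofReal_mul (by positivity),
                  ← ENNReal.ofReal_mul hB.le]
                congr 1
                rw [show -1 - μ = -μ - 1 by ring, Real.rpow_sub_one h0.ne']
                field_simp
      _ = _ := by
          rw [lintegral_const_mul _ (by fun_prop), ENNReal.ofReal_mul hB.le, ← hi,
            intervalIntegral.integral_of_le ht.le, ofReal_integral_eq_lintegral_ofReal]
          · exact hint.1
          · exact (ae_restrict_iff' measurableSet_Ioc).2
              (Filter.Eventually.of_forall fun t ht => Real.rpow_nonneg ht.1.le _)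
  have h2 : ∫⁻ t in Ioi t₀, ENNReal.ofReal (t ^ (-1 - μ)) *
        min (ENNReal.ofReal A) (ENNReal.ofReal t * ENNReal.ofReal B) ≤
      ENNReal.ofReal (A * (t₀ ^ (-μ) / μ)) := by
    have hi : ∫ t in Ioi t₀, t ^ (-1 - μ) = t₀ ^ (-μ) / μ := by
      rw [integral_Ioi_rpow_of_lt (by linarith) ht]
      rw [show -1 - μ + 1 = -μ by ring, neg_div_neg_eq]
    calc _ ≤ ∫⁻ t in Ioi t₀, ENNReal.ofReal A * ENNReal.ofReal (t ^ (-1 - μ)) := by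
          refine lintegral_mono fun t => ?_
          rw [mul_comm]
          gcongr; exact min_le_left _ _
      _ = _ := by
          rw [lintegral_const_mul _ (by fun_prop), ENNReal.ofReal_mul hA.le, ← hi,
            ofReal_integral_eq_lintegral_ofReal]
          · exact integrableOn_Ioi_rpow_of_lt (by linarith) ht
          · exact (ae_restrict_iff' measurableSet_Ioi).2
              (Filter.Eventually.of_forall fun t h => Real.rpow_nonneg (ht.trans h).le _)
  have hm1 : 0 < 1 - μ := by linarith
  refine (add_le_add h1 h2).trans ?_
  rw [← ENNReal.ofReal_add (by positivity) (by positivity), ← ENNReal.ofReal_mul (by positivity)]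
  refine ENNReal.ofReal_le_ofReal (le_of_eq ?_)
  have e1 : B * t₀ ^ (1 - μ) = A ^ (1 - μ) * B ^ μ := by
    rw [ht₀, Real.div_rpow hA.le hB.le, Real.rpow_sub hB, Real.rpow_one]; field_simp
  have e2 : A * t₀ ^ (-μ) = A ^ (1 - μ) * B ^ μ := by
    rw [ht₀, Real.div_rpow hA.le hB.le, Real.rpow_sub hA, Real.rpow_one, Real.rpow_neg hA.le,
      Real.rpow_neg hB.le]; field_simp
  calc _ = (B * t₀ ^ (1 - μ)) * (1 / (1 - μ)) + (A * t₀ ^ (-μ)) * (1 / μ) := by ring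
    _ = _ := by rw [e1, e2]; ring

/-- Let `S` be the indices where `A i ≤ t B i`. Truncate `f` at the height `c = ∑ B i` over the
complement of `S`: what exceeds `c` is at most the sum of the `g i` with `i ∈ S`, so the
`K`-functional bound gives `t c + ∑_S A i`, which is the sum of the minima. -/
theorem lintegral_rearrangement_le_tsum {f : EuclideanSpace ℝ (Fin d) → G}
    (hf : AEMeasurable (fun x => ‖f x‖)) {ι : Type*} [Countable ι]
    {g : ι → EuclideanSpace ℝ (Fin d) → ℝ≥0∞} {A B : ι → ℝ≥0∞} (hg : ∀ i, AEMeasurable (g i))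
    (hA : ∀ i, ∫⁻ x, g i x ≤ A i) (hB : ∀ i, ∀ᵐ x, g i x ≤ B i)
    (hfg : ∀ᵐ x, ‖f x‖ₑ ≤ ∑' i, g i x) {t : ℝ} (ht : 0 < t) :
    ∫⁻ s in Ioc 0 t, rearrangement f s ≤ ∑' i, min (A i) (ENNReal.ofReal t * B i) := by
  classical
  set S : Set ι := {i | A i ≤ ENNReal.ofReal t * B i} with hS
  have ht' : ENNReal.ofReal t ≠ 0 := by simpa using ht
  have hsplit : ∀ a : ι → ℝ≥0∞, ∑' i, a i = ∑' i, S.indicator a i + ∑' i, Sᶜ.indicator a i := by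
    intro a
    rw [← ENNReal.tsum_add]
    exact tsum_congr fun i => (congrFun (indicator_self_add_compl S a) i).symm
  have hmin : ∑' i, min (A i) (ENNReal.ofReal t * B i) =
      ∑' i, S.indicator A i + ENNReal.ofReal t * ∑' i, Sᶜ.indicator B i := by
    rw [hsplit, ← ENNReal.tsum_mul_left]
    congr 1
    · refine tsum_congr fun i => ?_
      by_cases h : i ∈ S
      · rw [indicator_of_mem h, indicator_of_mem h]; exact min_eq_left h
      · simp [h]
    · refine tsum_congr fun i => ?_
      by_cases h : i ∈ S
      · simp [h]
      · have : ENNReal.ofReal t * B i ≤ A i := (not_le.1 h).le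
        simpa [h] using this
  rcases eq_or_ne (∑' i, Sᶜ.indicator B i) ⊤ with htop | htop
  · rw [hmin, htop, ENNReal.mul_top ht', add_top]; exact le_top
  · have h := lintegral_rearrangement_le hf (∑' i, Sᶜ.indicator B i).toNNReal t
    rw [ENNReal.coe_toNNReal htop] at h
    refine h.trans ?_
    rw [hmin, add_comm]
    gcongr
    calc ∫⁻ x, (‖f x‖ₑ - ∑' i, Sᶜ.indicator B i) ≤ ∫⁻ x, ∑' i, S.indicator (fun i => g i x) i := by
          refine lintegral_mono_ae ?_
          filter_upwards [hfg, ae_all_iff.2 hB] with x hx hx'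
          rw [tsub_le_iff_right]
          refine hx.trans ?_
          rw [hsplit]
          gcongr with i
          exact hx' i
      _ = ∑' i, ∫⁻ x, S.indicator (fun i => g i x) i := by
          refine lintegral_tsum fun i => ?_
          by_cases h : i ∈ S
          · simpa [h] using hg i
          · simp [h]
      _ ≤ ∑' i, S.indicator A i := by
          refine ENNReal.tsum_le_tsum fun i => ?_
          by_cases h : i ∈ S
          · simpa [h] using hA i
          · simp [h]

/-- For `r = 1` the norm is the integral of `t^{-1-μ} ∫_0^t f^*`. The bound by minima is additive
over atoms, so the sum and the integral in `t` can be exchanged and each atom estimated alone. -/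
theorem AtomicBound.lorentzNorm_le {μ : ℝ} (hμ0 : 0 < μ) (hμ1 : μ < 1)
    {f : EuclideanSpace ℝ (Fin d) → G} (hf : AEMeasurable (fun x => ‖f x‖)) {M : ℝ≥0∞}
    (h : AtomicBound μ f M) {q : ℝ} (hq : 1 / q = 1 - μ) :
    lorentzNorm q 1 f ≤ ENNReal.ofReal (1 / (1 - μ) + 1 / μ) * M := by
  obtain ⟨ι, hι, g, A, B, h1, h2, h3, h4, h5, h6, h7⟩ := h
  simp only [lorentzNorm, ENNReal.rpow_one, div_one]
  calc ∫⁻ t in Ioi (0 : ℝ), ENNReal.ofReal (t ^ (1 / q)) * maximalRearrangement f t /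
        ENNReal.ofReal t
      ≤ ∫⁻ t in Ioi (0 : ℝ), ∑' i, ENNReal.ofReal (t ^ (-1 - μ)) *
        min (ENNReal.ofReal (A i)) (ENNReal.ofReal t * ENNReal.ofReal (B i)) := by
        refine setLIntegral_mono' measurableSet_Ioi fun t ht => ?_
        have ht' : 0 < t := ht
        have key := lintegral_rearrangement_le_tsum hf h1 h4 h5 h6 ht'
        rw [ENNReal.tsum_mul_left, maximalRearrangement, hq]
        calc _ = ENNReal.ofReal (t ^ (1 - μ)) * (ENNReal.ofReal t)⁻¹ * (ENNReal.ofReal t)⁻¹ *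
              ∫⁻ s in Ioc 0 t, rearrangement f s := by
              simp only [div_eq_mul_inv]; ring
          _ = ENNReal.ofReal (t ^ (-1 - μ)) * ∫⁻ s in Ioc 0 t, rearrangement f s := by
              congr 1
              rw [← ENNReal.ofReal_inv_of_pos ht', ← ENNReal.ofReal_mul (by positivity),
                ← ENNReal.ofReal_mul (by positivity)]
              congr 1
              rw [show -1 - μ = (1 - μ) - 1 - 1 by ring, Real.rpow_sub_one ht'.ne',
                Real.rpow_sub_one ht'.ne']
              field_simp
          _ ≤ _ := by gcongr
    _ = ∑' i, ∫⁻ t in Ioi (0 : ℝ), ENNReal.ofReal (t ^ (-1 - μ)) *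
        min (ENNReal.ofReal (A i)) (ENNReal.ofReal t * ENNReal.ofReal (B i)) := by
        refine lintegral_tsum fun i => ?_
        fun_prop
    _ ≤ ∑' i, ENNReal.ofReal (1 / (1 - μ) + 1 / μ) * ENNReal.ofReal (A i ^ (1 - μ) * B i ^ μ) :=
        ENNReal.tsum_le_tsum fun i => lintegral_rpow_mul_min_le hμ0 hμ1 (h2 i) (h3 i)
    _ ≤ _ := by rw [ENNReal.tsum_mul_left]; gcongr

end Lorentz

/-! ### Gradients -/

theorem contDiff_comp_inv_smul {E : Type*} [NormedAddCommGroup E]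
    [NormedSpace ℝ E] {K : E → ℝ} (hK : ContDiff ℝ 1 K) (s c : ℝ) :
    ContDiff ℝ 1 (fun x => c * K (s⁻¹ • x)) :=
  contDiff_const.mul (hK.comp (contDiff_const_smul _))

section Gradient

variable {E : Type*} [NormedAddCommGroup E] [InnerProductSpace ℝ E] [CompleteSpace E]

theorem norm_gradient (v : E → ℝ) (x : E) : ‖gradient v x‖ = ‖fderiv ℝ v x‖ := by
  rw [← toDual_gradient, LinearIsometryEquiv.norm_map]

theorem enorm_gradient (v : E → ℝ) (x : E) : ‖gradient v x‖ₑ = ‖fderiv ℝ v x‖ₑ := by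
  rw [← ofReal_norm, ← ofReal_norm, norm_gradient]

theorem continuous_gradient {v : E → ℝ} (hv : ContDiff ℝ 1 v) : Continuous (gradient v) :=
  (InnerProductSpace.toDual ℝ E).symm.continuous.comp (hv.continuous_fderiv (by simp))

theorem hasCompactSupport_gradient {v : E → ℝ} (hv : HasCompactSupport v) :
    HasCompactSupport (gradient v) :=
  (hv.fderiv (𝕜 := ℝ)).comp_left (g := (InnerProductSpace.toDual ℝ E).symm) (map_zero _)

/-- The gradient of a rescaled function. -/
theorem gradient_comp_inv_smul {K : E → ℝ} (hK : ContDiff ℝ 1 K) {s c : ℝ} (x : E) :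
    gradient (fun x => c * K (s⁻¹ • x)) x = (c * s⁻¹) • gradient K (s⁻¹ • x) := by
  have h1 : HasGradientAt K (gradient K (s⁻¹ • x)) (s⁻¹ • x) :=
    (hK.differentiable (by simp) _).hasGradientAt
  have h2 : HasFDerivAt (fun x : E => s⁻¹ • x) (s⁻¹ • ContinuousLinearMap.id ℝ E) x :=
    (hasFDerivAt_id x).const_smul s⁻¹
  have h3 := (h1.hasFDerivAt.comp x h2).const_mul c
  refine HasGradientAt.gradient ?_
  rw [hasGradientAt_iff_hasFDerivAt]
  refine h3.congr_fderiv ?_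
  ext w
  simp [mul_assoc]

end Gradient

/-! ### Convolution with a scalar kernel -/

section Convolution

variable {E : Type*} [NormedAddCommGroup E] [InnerProductSpace ℝ E] [FiniteDimensional ℝ E]
  [MeasurableSpace E] [BorelSpace E]
  {V : Type*} [NormedAddCommGroup V] [NormedSpace ℝ V]

theorem lintegral_comp_inv_smul (f : E → ℝ≥0∞) {s : ℝ} (hs : 0 < s) :
    ∫⁻ x, f (s⁻¹ • x) = ENNReal.ofReal (s ^ Module.finrank ℝ E) * ∫⁻ x, f x := by
  have hs' : s⁻¹ ≠ 0 := (inv_pos.2 hs).ne'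
  have h := lintegral_map_equiv (μ := (volume : Measure E)) f
    (Homeomorph.smulOfNeZero s⁻¹ hs').toMeasurableEquiv
  have h2 : Measure.map (Homeomorph.smulOfNeZero s⁻¹ hs').toMeasurableEquiv (volume : Measure E) =
      ENNReal.ofReal (s ^ Module.finrank ℝ E) • volume := by
    have := Measure.map_addHaar_smul (volume : Measure E) hs'
    rw [inv_pow, inv_inv, abs_of_pos (by positivity)] at this
    exact this
  rw [h2, lintegral_smul_measure] at h
  exact h.symm

/-- Convolution of a vector field with a scalar kernel. -/
noncomputable def kernelConv (K : E → ℝ) (G : E → V) (x : E) : V := ∫ y, K (x - y) • G y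

theorem aestronglyMeasurable_kernelConv_integrand {K : E → ℝ} {G : E → V}
    (hK : AEStronglyMeasurable K) (hG : AEStronglyMeasurable G) :
    AEStronglyMeasurable (fun p : E × E => K (p.1 - p.2) • G p.2) (volume.prod volume) :=
  AEStronglyMeasurable.convolution_integrand (ContinuousLinearMap.lsmul ℝ ℝ).flip hG hK

theorem aestronglyMeasurable_kernelConv {K : E → ℝ} {G : E → V}
    (hK : AEStronglyMeasurable K) (hG : AEStronglyMeasurable G) :
    AEStronglyMeasurable (kernelConv K G) :=
  (aestronglyMeasurable_kernelConv_integrand hK hG).integral_prod_right'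

theorem lintegral_lintegral_kernelConv_integrand {K : E → ℝ} {G : E → V}
    (hK : AEStronglyMeasurable K) (hG : AEStronglyMeasurable G) :
    ∫⁻ x, ∫⁻ y, ‖K (x - y) • G y‖ₑ = (∫⁻ x, ‖K x‖ₑ) * ∫⁻ x, ‖G x‖ₑ := by
  rw [lintegral_lintegral_swap (aestronglyMeasurable_kernelConv_integrand hK hG).enorm]
  simp_rw [enorm_smul]
  have : ∀ y, ∫⁻ x, ‖K (x - y)‖ₑ * ‖G y‖ₑ = (∫⁻ x, ‖K x‖ₑ) * ‖G y‖ₑ := by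
    intro y
    rw [lintegral_mul_const' _ _ enorm_ne_top,
      lintegral_sub_right_eq_self (fun x => ‖K x‖ₑ) y]
  simp_rw [this]
  rw [lintegral_const_mul'' _ hG.enorm]

theorem lintegral_kernelConv_le {K : E → ℝ} {G : E → V}
    (hK : AEStronglyMeasurable K) (hG : AEStronglyMeasurable G) :
    ∫⁻ x, ‖kernelConv K G x‖ₑ ≤ (∫⁻ x, ‖K x‖ₑ) * ∫⁻ x, ‖G x‖ₑ := by
  rw [← lintegral_lintegral_kernelConv_integrand hK hG]
  exact lintegral_mono fun x => enorm_integral_le_lintegral_enorm _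

theorem integrable_gradient {v : E → ℝ} (hv : ContDiff ℝ 1 v) (hv' : HasCompactSupport v) :
    Integrable (gradient v) :=
  (continuous_gradient hv).integrable_of_hasCompactSupport (hasCompactSupport_gradient hv')

/-- Integration by parts, with no boundary term since `v` has compact support. This is the only
place where the gradient structure improves on general fields: sup bounds then see `v` in place of
`∇v`. -/
theorem kernelConv_gradient {K v : E → ℝ} (hK : ContDiff ℝ 1 K) (hv : ContDiff ℝ 1 v)
    (hv' : HasCompactSupport v) (x : E) :
    kernelConv K (gradient v) x = ∫ y, v y • gradient K (x - y) := by
  have hKx : ContDiff ℝ 1 fun y => K (x - y) := hK.comp (contDiff_const.sub contDiff_id)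
  have hfd : ∀ y w, fderiv ℝ (fun y => K (x - y)) y w = - fderiv ℝ K (x - y) w := by
    intro y w
    have := (hK.differentiable (by simp) (x - y)).hasFDerivAt.comp y
      ((hasFDerivAt_id y).const_sub x)
    have h := this.fderiv
    simp only [Function.comp_def] at h
    rw [h]; simp
  have hgK : Continuous fun y => gradient K (x - y) :=
    (continuous_gradient hK).comp (continuous_const.sub continuous_id)
  have i1 : Integrable fun y => K (x - y) • gradient v y :=
    (hKx.continuous.smul (continuous_gradient hv)).integrable_of_hasCompactSupport
      (hasCompactSupport_gradient hv').smul_left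
  have i2 : Integrable fun y => v y • gradient K (x - y) :=
    (hv.continuous.smul hgK).integrable_of_hasCompactSupport hv'.smul_right
  refine ext_inner_left ℝ fun w => ?_
  rw [kernelConv, ← integral_inner i1, ← integral_inner i2]
  have hin : ∀ f : E → ℝ, ∀ y, inner ℝ w (gradient f y) = fderiv ℝ f y w := fun f y => by
    rw [real_inner_comm, inner_gradient_left]
  simp_rw [inner_smul_right, hin]
  have c1 : ∀ w, Continuous fun y => fderiv ℝ v y w := fun w =>
    (hv.continuous_fderiv (by simp)).clm_apply continuous_const
  have c2 : ∀ w, Continuous fun y => fderiv ℝ (fun y => K (x - y)) y w := fun w =>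
    (hKx.continuous_fderiv (by simp)).clm_apply continuous_const
  rw [integral_mul_fderiv_eq_neg_fderiv_mul_of_integrable]
  · rw [← integral_neg]
    refine integral_congr_ae (Filter.Eventually.of_forall fun y => ?_)
    simp only [hfd]; ring
  · exact ((c2 w).mul hv.continuous).integrable_of_hasCompactSupport hv'.mul_left
  · exact (hKx.continuous.mul (c1 w)).integrable_of_hasCompactSupport
      (HasCompactSupport.mul_left (hv'.fderiv_apply ℝ w))
  · exact (hKx.continuous.mul hv.continuous).integrable_of_hasCompactSupport hv'.mul_left
  · exact fun y _ => hKx.differentiable (by simp) y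
  · exact fun y _ => hv.differentiable (by simp) y

/-- This bound and the next distribute `v` and `∇K` over `L^∞` and `L¹` in the two possible ways.
The first is efficient for kernels narrower than the scale of `v`, the second for wider ones. -/
theorem enorm_kernelConv_gradient_le {K v : E → ℝ} (hK : ContDiff ℝ 1 K) (hv : ContDiff ℝ 1 v)
    (hv' : HasCompactSupport v) {a : ℝ≥0∞} (ha : ∀ y, ‖v y‖ₑ ≤ a) (x : E) :
    ‖kernelConv K (gradient v) x‖ₑ ≤ a * ∫⁻ y, ‖gradient K y‖ₑ := by
  rw [kernelConv_gradient hK hv hv']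
  calc _ ≤ ∫⁻ y, ‖v y • gradient K (x - y)‖ₑ := enorm_integral_le_lintegral_enorm _
    _ ≤ ∫⁻ y, a * ‖gradient K (x - y)‖ₑ := by
        refine lintegral_mono fun y => ?_
        rw [enorm_smul]; gcongr; exact ha y
    _ = _ := by
        rw [lintegral_const_mul, lintegral_sub_left_eq_self (fun y => ‖gradient K y‖ₑ)]
        exact ((continuous_gradient hK).comp (continuous_const.sub continuous_id)).enorm.measurable

theorem enorm_kernelConv_gradient_le' {K v : E → ℝ} (hK : ContDiff ℝ 1 K) (hv : ContDiff ℝ 1 v)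
    (hv' : HasCompactSupport v) {a : ℝ≥0∞} (ha : ∀ y, ‖gradient K y‖ₑ ≤ a) (x : E) :
    ‖kernelConv K (gradient v) x‖ₑ ≤ a * ∫⁻ y, ‖v y‖ₑ := by
  rw [kernelConv_gradient hK hv hv']
  calc _ ≤ ∫⁻ y, ‖v y • gradient K (x - y)‖ₑ := enorm_integral_le_lintegral_enorm _
    _ ≤ ∫⁻ y, a * ‖v y‖ₑ := by
        refine lintegral_mono fun y => ?_
        rw [enorm_smul, mul_comm]; gcongr; exact ha _
    _ = _ := by
        rw [lintegral_const_mul]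
        exact hv.continuous.enorm.measurable

end Convolution

/-! ### The Riesz kernel and its dyadic decomposition -/

section RieszKernel

open Filter Topology

/-- Multiplying a power by a smooth function vanishing on `(-∞, 1)` gives a smooth function. -/
theorem contDiff_rpow_mul_of_eq_zero {φ : ℝ → ℝ} (hφ : ContDiff ℝ ∞ φ)
    (h0 : ∀ s < 1, φ s = 0) (p : ℝ) : ContDiff ℝ ∞ fun s : ℝ => s ^ p * φ s := by
  rw [contDiff_iff_contDiffAt]
  intro s
  rcases lt_or_ge s 1 with hs | hs
  · have : (fun s : ℝ => s ^ p * φ s) =ᶠ[𝓝 s] fun _ => 0 := by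
      filter_upwards [Iio_mem_nhds hs] with t ht
      rw [h0 t ht, mul_zero]
    exact contDiffAt_const.congr_of_eventuallyEq this
  · exact (Real.contDiffAt_rpow_const_of_ne (by linarith)).mul hφ.contDiffAt

/-- The profile of the dyadic pieces of the kernel `|x|^{-β}`, as a function of `|x|²`. -/
noncomputable def dyadicProfile (β s : ℝ) : ℝ :=
  s ^ (-β / 2) * (Real.smoothTransition (s - 1) - Real.smoothTransition (s / 4 - 1))

theorem contDiff_dyadicProfile (β : ℝ) : ContDiff ℝ ∞ (dyadicProfile β) := by
  refine contDiff_rpow_mul_of_eq_zero ?_ (fun s hs => ?_) _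
  · exact (Real.smoothTransition.contDiff.comp (contDiff_id.sub contDiff_const)).sub
      (Real.smoothTransition.contDiff.comp ((contDiff_id.div_const 4).sub contDiff_const))
  · rw [Real.smoothTransition.zero_of_nonpos (by linarith),
      Real.smoothTransition.zero_of_nonpos (by linarith), sub_zero]

theorem dyadicProfile_nonneg (β : ℝ) {s : ℝ} (hs : 0 ≤ s) : 0 ≤ dyadicProfile β s :=
  mul_nonneg (Real.rpow_nonneg hs _)
    (sub_nonneg.2 (Real.smoothTransition.monotone (by linarith)))

theorem dyadicProfile_eq_zero (β : ℝ) {s : ℝ} (hs : 8 ≤ s) : dyadicProfile β s = 0 := by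
  rw [dyadicProfile, Real.smoothTransition.one_of_one_le (by linarith),
    Real.smoothTransition.one_of_one_le (by linarith), sub_self, mul_zero]

/-- Telescoping in both directions: the half `j ≥ 0` contributes `a 0`, the half `j < 0` contributes
`1 - a 0`. -/
theorem hasSum_int_sub_of_antitone {a : ℤ → ℝ} (ha : Antitone a)
    (h0 : Tendsto (fun n : ℕ => a n) atTop (𝓝 0))
    (h1 : Tendsto (fun n : ℕ => a (-(n : ℤ))) atTop (𝓝 1)) :
    HasSum (fun j : ℤ => a j - a (j + 1)) 1 := by
  have hnn : ∀ j, 0 ≤ a j - a (j + 1) := fun j => sub_nonneg.2 (ha (by lia))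
  have p : HasSum (fun n : ℕ => a n - a (n + 1)) (a 0) := by
    rw [hasSum_iff_tendsto_nat_of_nonneg (fun n => hnn n)]
    have : ∀ n : ℕ, ∑ i ∈ Finset.range n, (a (i : ℤ) - a (i + 1)) = a 0 - a n := by
      intro n
      have := Finset.sum_range_sub' (fun i : ℕ => a i) n
      simpa using this
    simp_rw [this]
    simpa using h0.const_sub (a 0)
  have q : HasSum (fun n : ℕ => a (-((n : ℤ) + 1)) - a (-((n : ℤ) + 1) + 1)) (1 - a 0) := by
    rw [hasSum_iff_tendsto_nat_of_nonneg (fun n => hnn _)]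
    have : ∀ n : ℕ, ∑ i ∈ Finset.range n, (a (-((i : ℤ) + 1)) - a (-((i : ℤ) + 1) + 1)) =
        a (-(n : ℤ)) - a 0 := by
      intro n
      have := Finset.sum_range_sub (fun i : ℕ => a (-(i : ℤ))) n
      simp only [Nat.cast_zero, neg_zero] at this
      rw [← this]
      refine Finset.sum_congr rfl fun i _ => ?_
      push_cast
      congr 2
      ring
    simp_rw [this]
    exact h1.sub_const _
  have := HasSum.of_nat_of_neg_add_one (f := fun j : ℤ => a j - a (j + 1)) p q
  simpa using this

variable {E : Type*} [NormedAddCommGroup E] [InnerProductSpace ℝ E]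

/-- The unit dyadic piece of the kernel `|x|^{-β}`. -/
noncomputable def dyadicKernel {E : Type*} [NormedAddCommGroup E] (β : ℝ) (x : E) : ℝ := dyadicProfile β (‖x‖ ^ 2)

theorem contDiff_dyadicKernel (β : ℝ) : ContDiff ℝ ∞ (dyadicKernel β : E → ℝ) :=
  (contDiff_dyadicProfile β).comp (contDiff_norm_sq ℝ)

theorem dyadicKernel_nonneg {E : Type*} [NormedAddCommGroup E] (β : ℝ) (x : E) :
    0 ≤ dyadicKernel β x :=
  dyadicProfile_nonneg β (by positivity)

theorem hasCompactSupport_dyadicKernel [FiniteDimensional ℝ E] (β : ℝ) :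
    HasCompactSupport (dyadicKernel β : E → ℝ) := by
  refine HasCompactSupport.intro (isCompact_closedBall 0 3) fun x hx => ?_
  have : 3 < ‖x‖ := by simpa using hx
  exact dyadicProfile_eq_zero β (by nlinarith)

/-- The divisor `4` in the profile acts on `‖x‖²`, hence doubles the scale. The pieces at scales
`2^j` are thus differences of consecutive cutoffs and telescope. -/
theorem rpow_mul_dyadicKernel (β : ℝ) {s : ℝ} (hs : 0 < s) (x : E) :
    s ^ (-β) * dyadicKernel β (s⁻¹ • x) = ‖x‖ ^ (-β) *
      (Real.smoothTransition (‖x‖ ^ 2 / s ^ 2 - 1) -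
        Real.smoothTransition (‖x‖ ^ 2 / (2 * s) ^ 2 - 1)) := by
  have h1 : ‖s⁻¹ • x‖ = ‖x‖ / s := by
    rw [norm_smul, norm_inv, Real.norm_of_nonneg hs.le]; ring
  have h2 : ((‖x‖ / s) ^ 2) ^ (-β / 2) = (‖x‖ / s) ^ (-β) := by
    rw [← Real.rpow_natCast, ← Real.rpow_mul (by positivity)]
    congr 1; push_cast; ring
  have h3 : s ^ (-β) * (‖x‖ / s) ^ (-β) = ‖x‖ ^ (-β) := by
    rw [← Real.mul_rpow hs.le (by positivity)]
    congr 1; field_simp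
  rw [dyadicKernel, dyadicProfile, h1, h2, ← mul_assoc, h3]
  have h4 : (‖x‖ / s) ^ 2 = ‖x‖ ^ 2 / s ^ 2 := div_pow _ _ _
  have h5 : (‖x‖ / s) ^ 2 / 4 = ‖x‖ ^ 2 / (2 * s) ^ 2 := by field_simp; norm_num
  rw [h5, h4]

theorem hasSum_dyadicKernel {β : ℝ} (hβ : 0 < β) (x : E) :
    HasSum (fun j : ℤ => ((2 : ℝ) ^ j) ^ (-β) * dyadicKernel β (((2 : ℝ) ^ j)⁻¹ • x))
      (‖x‖ ^ (-β)) := by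
  simp_rw [fun j : ℤ => rpow_mul_dyadicKernel β (show (0 : ℝ) < 2 ^ j by positivity) x]
  -- At the origin both sides are `0`, by the convention `0 ^ (-β) = 0`.
  rcases eq_or_ne x 0 with rfl | hx
  · simp [Real.zero_rpow (neg_ne_zero.2 hβ.ne')]
  · have hx' : 0 < ‖x‖ ^ 2 := by positivity
    set a : ℤ → ℝ := fun j => Real.smoothTransition (‖x‖ ^ 2 / ((2 : ℝ) ^ j) ^ 2 - 1) with ha
    have h : HasSum (fun j : ℤ => a j - a (j + 1)) 1 := by
      refine hasSum_int_sub_of_antitone ?_ ?_ ?_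
      · intro i j hij
        refine Real.smoothTransition.monotone ?_
        gcongr
        norm_num
      · have h1 : Tendsto (fun n : ℕ => ‖x‖ ^ 2 / ((2 : ℝ) ^ (n : ℤ)) ^ 2 - 1) atTop (𝓝 (-1)) := by
          have : Tendsto (fun n : ℕ => ‖x‖ ^ 2 * ((1 / 4 : ℝ)) ^ n - 1) atTop
              (𝓝 (‖x‖ ^ 2 * 0 - 1)) :=
            ((tendsto_pow_atTop_nhds_zero_of_lt_one (by norm_num) (by norm_num)).const_mul
              _).sub_const _
          rw [mul_zero, zero_sub] at this
          refine this.congr fun n => ?_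
          rw [zpow_natCast, ← pow_mul, mul_comm n 2, pow_mul, div_eq_mul_inv (‖x‖ ^ 2), one_div, inv_pow]
          norm_num
        have h2 := (Real.smoothTransition.continuous.tendsto (-1)).comp h1
        rw [Real.smoothTransition.zero_of_nonpos (by norm_num)] at h2
        exact h2
      -- For very small scales the cutoff is exactly `1` at the fixed nonzero `x`.
      · refine tendsto_const_nhds.congr' ?_
        have h1 : Tendsto (fun n : ℕ => ‖x‖ ^ 2 * (4 : ℝ) ^ n) atTop atTop :=
          (tendsto_pow_atTop_atTop_of_one_lt (by norm_num)).const_mul_atTop hx'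
        filter_upwards [h1.eventually_ge_atTop 2] with n hn
        refine (Real.smoothTransition.one_of_one_le ?_).symm
        have : ‖x‖ ^ 2 / ((2 : ℝ) ^ (-(n : ℤ))) ^ 2 = ‖x‖ ^ 2 * (4 : ℝ) ^ n := by
          rw [zpow_neg, zpow_natCast, inv_pow, div_inv_eq_mul, ← pow_mul, mul_comm n 2, pow_mul]
          norm_num
        rw [this]; linarith
    have h' := h.mul_left (‖x‖ ^ (-β))
    rw [mul_one] at h'
    refine h'.congr_fun fun j => ?_
    simp only [ha]
    rw [zpow_add_one₀ two_ne_zero, mul_comm ((2 : ℝ) ^ j) 2]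

variable [FiniteDimensional ℝ E] [MeasurableSpace E] [BorelSpace E]
  {V : Type*} [NormedAddCommGroup V] [NormedSpace ℝ V]

/-- The kernel is integrable near the origin because `β` is less than the dimension, and it is at
most `1` elsewhere. The local part convolved with `φ` is integrable, and the rest contributes at
most `∫ φ`. -/
theorem ae_lintegral_rpow_mul_lt_top {β : ℝ} (hβ : 0 < β) (hβn : β < Module.finrank ℝ E)
    {φ : E → ℝ≥0∞} (hφ : AEMeasurable φ) (hφ' : ∫⁻ y, φ y ≠ ⊤) :
    ∀ᵐ x : E, ∫⁻ y, ENNReal.ofReal (‖x - y‖ ^ (-β)) * φ y < ⊤ := by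
  set k : E → ℝ≥0∞ := (Metric.ball 0 1).indicator fun x => ENNReal.ofReal (‖x‖ ^ (-β)) with hk
  have hkm : Measurable k :=
    Measurable.indicator (by fun_prop) measurableSet_ball
  have hk1 : ∫⁻ x, k x ≠ ⊤ := by
    have hn : 1 ≤ Module.finrank ℝ E := by
      have : (0 : ℝ) < Module.finrank ℝ E := hβ.trans hβn
      exact_mod_cast this
    have : IntegrableOn (fun x : E => ‖x‖ ^ (-β)) (Metric.ball 0 1) volume := by
      refine integrableOn_ball_of_norm_le_rpow hn hβn (C := 1) ?_ ?_
      · refine Filter.Eventually.of_forall fun x => ?_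
        rw [one_mul, Real.norm_of_nonneg (by positivity)]
      · exact (by fun_prop : Measurable fun x : E => ‖x‖ ^ (-β)).aestronglyMeasurable
    rw [lintegral_indicator measurableSet_ball]
    have h2 := this.2
    rw [hasFiniteIntegral_iff_ofReal
      (Filter.Eventually.of_forall fun x => by positivity)] at h2
    exact h2.ne
  have hle : ∀ x : E, ENNReal.ofReal (‖x‖ ^ (-β)) ≤ k x + 1 := by
    intro x
    by_cases hx : x ∈ Metric.ball (0 : E) 1
    · rw [hk, indicator_of_mem hx]; exact le_self_add
    · have hx' : 1 ≤ ‖x‖ := by simpa using hx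
      refine le_trans ?_ le_add_self
      rw [ENNReal.ofReal_le_one]
      exact Real.rpow_le_one_of_one_le_of_nonpos hx' (by linarith)
  have hm : AEMeasurable (fun p : E × E => k (p.1 - p.2) * φ p.2) (volume.prod volume) :=
    (hkm.comp (measurable_fst.sub measurable_snd)).aemeasurable.mul hφ.comp_snd
  have hfin : ∫⁻ x, ∫⁻ y, k (x - y) * φ y ≠ ⊤ := by
    rw [lintegral_lintegral_swap hm]
    have : ∀ y, ∫⁻ x, k (x - y) * φ y = (∫⁻ x, k x) * φ y := by
      intro y
      rw [lintegral_mul_const _ (by fun_prop), lintegral_sub_right_eq_self k y]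
    simp_rw [this]
    rw [lintegral_const_mul'' _ hφ]
    exact ENNReal.mul_ne_top hk1 hφ'
  filter_upwards [ae_lt_top' hm.lintegral_prod_right' hfin] with x hx
  calc ∫⁻ y, ENNReal.ofReal (‖x - y‖ ^ (-β)) * φ y ≤ ∫⁻ y, (k (x - y) * φ y + φ y) := by
        refine lintegral_mono fun y => ?_
        refine (mul_le_mul_left (hle _) _).trans ?_
        rw [add_mul, one_mul]
    _ = (∫⁻ y, k (x - y) * φ y) + ∫⁻ y, φ y := lintegral_add_right' _ hφ
    _ < ⊤ := ENNReal.add_lt_top.2 ⟨hx, hφ'.lt_top⟩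

theorem ae_integrable_rpow_smul {β : ℝ} (hβ : 0 < β) (hβn : β < Module.finrank ℝ E)
    {G : E → V} (hG : Integrable G) :
    ∀ᵐ x : E, Integrable fun y => ‖x - y‖ ^ (-β) • G y := by
  filter_upwards [ae_lintegral_rpow_mul_lt_top hβ hβn hG.1.enorm hG.2.ne] with x hx
  refine ⟨AEStronglyMeasurable.smul
    (by fun_prop : Measurable fun y : E => ‖x - y‖ ^ (-β)).aestronglyMeasurable hG.1, ?_⟩
  refine lt_of_le_of_lt (lintegral_mono fun y => ?_) hx
  rw [enorm_smul, Real.enorm_of_nonneg (by positivity)]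

/-- The kernel pieces are nonnegative, so the series of absolute values sums to the original
integrand in norm; this is the dominating function. -/
theorem enorm_kernelConv_rpow_le_tsum {β : ℝ} (hβ : 0 < β) {G : E → V}
    (hG : AEStronglyMeasurable G) {x : E} (hx : Integrable fun y => ‖x - y‖ ^ (-β) • G y) :
    ‖kernelConv (fun x => ‖x‖ ^ (-β)) G x‖ₑ ≤ ∑' j : ℤ,
      ‖kernelConv (fun x => ((2 : ℝ) ^ j) ^ (-β) * dyadicKernel β (((2 : ℝ) ^ j)⁻¹ • x)) G x‖ₑ := by
  have hs := fun y => hasSum_dyadicKernel hβ (x - y)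
  have hnn : ∀ (j : ℤ) (y : E),
      0 ≤ ((2 : ℝ) ^ j) ^ (-β) * dyadicKernel β (((2 : ℝ) ^ j)⁻¹ • (x - y)) := fun j y =>
    mul_nonneg (by positivity) (dyadicKernel_nonneg _ _)
  have h := hasSum_integral_of_dominated_convergence (μ := (volume : Measure E))
    (F := fun (j : ℤ) y =>
      (((2 : ℝ) ^ j) ^ (-β) * dyadicKernel β (((2 : ℝ) ^ j)⁻¹ • (x - y))) • G y)
    (f := fun y => ‖x - y‖ ^ (-β) • G y)
    (fun j y => (((2 : ℝ) ^ j) ^ (-β) * dyadicKernel β (((2 : ℝ) ^ j)⁻¹ • (x - y))) * ‖G y‖)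
    (fun j => ?_) (fun j => ?_) ?_ ?_ ?_
  · have hsum := h.tsum_eq
    simp only [kernelConv]
    rw [← hsum]
    exact enorm_tsum_le_tsum_enorm
  · refine AEStronglyMeasurable.smul (Continuous.aestronglyMeasurable ?_) hG
    exact continuous_const.mul ((contDiff_dyadicKernel β).continuous.comp (by fun_prop))
  · refine Eventually.of_forall fun y => ?_
    rw [norm_smul, Real.norm_of_nonneg (hnn j y)]
  · exact Eventually.of_forall fun y => (hs y).summable.mul_right _
  · refine hx.norm.congr (Eventually.of_forall fun y => ?_)
    simp only
    rw [tsum_mul_right, (hs y).tsum_eq, norm_smul, Real.norm_of_nonneg (by positivity)]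
  · exact Eventually.of_forall fun y => (hs y).smul_const _

end RieszKernel

/-! ### Riesz potentials of gradients of functions adapted to one scale -/

section Atom

theorem summable_pow_natAbs {r : ℝ} (h0 : 0 ≤ r) (h1 : r < 1) :
    Summable fun i : ℤ => r ^ i.natAbs := by
  refine Summable.of_nat_of_neg ?_ ?_ <;>
  simpa using summable_geometric_of_lt_one h0 h1

theorem exists_tsum_min_rpow_le {a b : ℝ} (ha : 0 < a) (hb : 0 < b) :
    ∃ C : ℝ, 0 < C ∧ ∀ ρ : ℝ, 0 < ρ →
      ∑' j : ℤ, ENNReal.ofReal (min (((2 : ℝ) ^ j / ρ) ^ a) (((2 : ℝ) ^ j / ρ) ^ (-b))) ≤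
        ENNReal.ofReal C := by
  set r : ℝ := max ((2 : ℝ) ^ (-a)) ((2 : ℝ) ^ (-b)) with hr
  have hr0 : 0 < r := lt_max_of_lt_left (by positivity)
  have hr1 : r < 1 := max_lt (Real.rpow_lt_one_of_one_lt_of_neg one_lt_two (by linarith))
    (Real.rpow_lt_one_of_one_lt_of_neg one_lt_two (by linarith))
  have hsum := (summable_pow_natAbs hr0.le hr1).mul_left ((2 : ℝ) ^ b)
  have hnn : ∀ i : ℤ, 0 ≤ (2 : ℝ) ^ b * r ^ i.natAbs := fun i => by positivity
  refine ⟨∑' i : ℤ, (2 : ℝ) ^ b * r ^ i.natAbs, hsum.tsum_pos hnn 0 (by positivity), ?_⟩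
  intro ρ hρ
  -- Rounding `ρ` down to `2^m` and shifting the index by `m` changes `2^j / ρ` by a factor of at
  -- most `2`. This explains the `2^b` in the constant, which stays independent of `ρ`.
  obtain ⟨m, hm1, hm2⟩ := exists_mem_Ico_zpow hρ one_lt_two
  rw [ENNReal.ofReal_tsum_of_nonneg hnn hsum, ← (Equiv.addRight m).tsum_eq]
  refine ENNReal.tsum_le_tsum fun i => ENNReal.ofReal_le_ofReal ?_
  simp only [Equiv.coe_addRight]
  have h2m : (0 : ℝ) < 2 ^ m := by positivity
  have hz1 : (2 : ℝ) ^ (i + m) / ρ ≤ 2 ^ i := by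
    rw [zpow_add₀ two_ne_zero, div_le_iff₀ hρ]; gcongr
  have hz2 : (2 : ℝ) ^ (i - 1) ≤ (2 : ℝ) ^ (i + m) / ρ := by
    rw [le_div_iff₀ hρ, show i + m = (i - 1) + (m + 1) by ring,
      zpow_add₀ two_ne_zero (i - 1)]
    gcongr
  have hz0 : 0 < (2 : ℝ) ^ (i + m) / ρ := by positivity
  rcases le_or_gt i 0 with hi | hi
  · refine (min_le_left _ _).trans ?_
    obtain ⟨n, rfl⟩ : ∃ n : ℕ, i = -(n : ℤ) := ⟨i.natAbs, by lia⟩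
    calc ((2 : ℝ) ^ (-(n : ℤ) + m) / ρ) ^ a ≤ ((2 : ℝ) ^ (-(n : ℤ))) ^ a :=
          Real.rpow_le_rpow hz0.le hz1 ha.le
      _ = ((2 : ℝ) ^ (-a)) ^ n := by
          rw [← Real.rpow_intCast, ← Real.rpow_natCast, ← Real.rpow_mul two_pos.le,
            ← Real.rpow_mul two_pos.le]
          congr 1; push_cast; ring
      _ ≤ r ^ n := by gcongr; exact le_max_left _ _
      _ ≤ _ := by
          rw [Int.natAbs_neg, Int.natAbs_natCast]
          exact le_mul_of_one_le_left (by positivity) (Real.one_le_rpow one_le_two hb.le)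
  · refine (min_le_right _ _).trans ?_
    obtain ⟨n, rfl⟩ : ∃ n : ℕ, i = (n : ℤ) := ⟨i.natAbs, by lia⟩
    calc ((2 : ℝ) ^ ((n : ℤ) + m) / ρ) ^ (-b) ≤ ((2 : ℝ) ^ ((n : ℤ) - 1)) ^ (-b) :=
          Real.rpow_le_rpow_of_nonpos (by positivity) hz2 (by linarith)
      _ = 2 ^ b * ((2 : ℝ) ^ (-b)) ^ n := by
          rw [← Real.rpow_intCast, ← Real.rpow_natCast, ← Real.rpow_mul two_pos.le,
            ← Real.rpow_mul two_pos.le, ← Real.rpow_add two_pos]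
          congr 1; push_cast; ring
      _ ≤ 2 ^ b * r ^ n := by gcongr; exact le_max_right _ _
      _ = _ := by rw [Int.natAbs_natCast]

variable {E : Type*} [NormedAddCommGroup E] [InnerProductSpace ℝ E] [FiniteDimensional ℝ E]
  [MeasurableSpace E] [BorelSpace E]

/-- Bounds for one dyadic piece of the Riesz potential of a gradient. -/
theorem exists_dyadic_bounds (β : ℝ) : ∃ c : ℝ, 0 < c ∧ ∀ (v : E → ℝ) (s : ℝ),
    ContDiff ℝ 1 v → HasCompactSupport v → 0 < s →
    (∀ N : ℝ, 0 ≤ N → ∫⁻ x, ‖gradient v x‖ₑ ≤ ENNReal.ofReal N →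
      ∫⁻ x, ‖kernelConv (fun x => s ^ (-β) * dyadicKernel β (s⁻¹ • x)) (gradient v) x‖ₑ ≤
        ENNReal.ofReal (c * (s ^ (Module.finrank ℝ E - β) * N))) ∧
    (∀ N : ℝ, 0 ≤ N → (∀ x, |v x| ≤ N) → ∀ x,
      ‖kernelConv (fun x => s ^ (-β) * dyadicKernel β (s⁻¹ • x)) (gradient v) x‖ₑ ≤
        ENNReal.ofReal (c * (s ^ (Module.finrank ℝ E - β - 1) * N))) ∧
    (∀ N : ℝ, 0 ≤ N → ∫⁻ x, ‖v x‖ₑ ≤ ENNReal.ofReal N → ∀ x,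
      ‖kernelConv (fun x => s ^ (-β) * dyadicKernel β (s⁻¹ • x)) (gradient v) x‖ₑ ≤
        ENNReal.ofReal (c * (s ^ (-β - 1) * N))) := by
  set k : E → ℝ := dyadicKernel β with hk
  have hk1 : ContDiff ℝ 1 k := (contDiff_dyadicKernel β).of_le (by exact_mod_cast le_top)
  have hkc : HasCompactSupport k := hasCompactSupport_dyadicKernel β
  have hgk := continuous_gradient hk1
  have hgkc := hasCompactSupport_gradient hkc
  obtain ⟨c₁, hc₁⟩ : ∃ c : ℝ, 0 ≤ c ∧ ∫⁻ x, ‖k x‖ₑ ≤ ENNReal.ofReal c :=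
    ⟨(∫⁻ x, ‖k x‖ₑ).toReal, ENNReal.toReal_nonneg, by
      rw [ENNReal.ofReal_toReal (hk1.continuous.integrable_of_hasCompactSupport hkc).2.ne]⟩
  obtain ⟨c₂, hc₂⟩ : ∃ c : ℝ, 0 ≤ c ∧ ∫⁻ x, ‖gradient k x‖ₑ ≤ ENNReal.ofReal c :=
    ⟨(∫⁻ x, ‖gradient k x‖ₑ).toReal, ENNReal.toReal_nonneg, by
      rw [ENNReal.ofReal_toReal (integrable_gradient hk1 hkc).2.ne]⟩
  obtain ⟨c₃, hc₃⟩ := hgkc.exists_bound_of_continuous hgk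
  have hc₃0 : 0 ≤ c₃ := (norm_nonneg _).trans (hc₃ 0)
  refine ⟨1 + c₁ + c₂ + c₃, by linarith [hc₁.1, hc₂.1], fun v s hv hvc hs => ?_⟩
  have hc₁' := hc₁.1
  have hc₂' := hc₂.1
  have hK1 : ContDiff ℝ 1 fun x => s ^ (-β) * k (s⁻¹ • x) := contDiff_comp_inv_smul hk1 s _
  have hKint : ∫⁻ x, ‖s ^ (-β) * k (s⁻¹ • x)‖ₑ ≤
      ENNReal.ofReal (s ^ (Module.finrank ℝ E - β) * c₁) := by
    simp_rw [enorm_mul]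
    rw [lintegral_const_mul' _ _ enorm_ne_top,
      lintegral_comp_inv_smul (fun x => ‖k x‖ₑ) hs, Real.enorm_of_nonneg (by positivity)]
    calc _ ≤ ENNReal.ofReal (s ^ (-β)) *
          (ENNReal.ofReal (s ^ Module.finrank ℝ E) * ENNReal.ofReal c₁) := by gcongr; exact hc₁.2
      _ = _ := by
          rw [← ENNReal.ofReal_mul (by positivity), ← ENNReal.ofReal_mul (by positivity)]
          congr 1
          rw [← mul_assoc, ← Real.rpow_natCast s, ← Real.rpow_add hs]
          ring_nf
  have hgr : ∀ x, gradient (fun x => s ^ (-β) * k (s⁻¹ • x)) x =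
      (s ^ (-β) * s⁻¹) • gradient k (s⁻¹ • x) := fun x => gradient_comp_inv_smul hk1 x
  have hss : s ^ (-β) * s⁻¹ = s ^ (-β - 1) := by
    rw [Real.rpow_sub_one hs.ne']; rfl
  have hGint : ∫⁻ x, ‖gradient (fun x => s ^ (-β) * k (s⁻¹ • x)) x‖ₑ ≤
      ENNReal.ofReal (s ^ (Module.finrank ℝ E - β - 1) * c₂) := by
    simp_rw [hgr, enorm_smul, hss]
    rw [lintegral_const_mul' _ _ enorm_ne_top,
      lintegral_comp_inv_smul (fun x => ‖gradient k x‖ₑ) hs, Real.enorm_of_nonneg (by positivity)]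
    calc _ ≤ ENNReal.ofReal (s ^ (-β - 1)) *
          (ENNReal.ofReal (s ^ Module.finrank ℝ E) * ENNReal.ofReal c₂) := by gcongr; exact hc₂.2
      _ = _ := by
          rw [← ENNReal.ofReal_mul (by positivity), ← ENNReal.ofReal_mul (by positivity)]
          congr 1
          rw [← mul_assoc, ← Real.rpow_natCast s, ← Real.rpow_add hs]
          ring_nf
  have hGsup : ∀ x, ‖gradient (fun x => s ^ (-β) * k (s⁻¹ • x)) x‖ₑ ≤
      ENNReal.ofReal (s ^ (-β - 1) * c₃) := by
    intro x
    rw [hgr, hss, ← ofReal_norm, norm_smul, Real.norm_of_nonneg (by positivity)]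
    gcongr
    exact hc₃ _
  -- The first bound is Young's inequality for the rescaled kernel; the other two integrate by parts
  -- and use the `L¹` and sup norms of its gradient.
  refine ⟨fun N hN h => ?_, fun N hN h x => ?_, fun N hN h x => ?_⟩
  · refine (lintegral_kernelConv_le hK1.continuous.aestronglyMeasurable
      (continuous_gradient hv).aestronglyMeasurable).trans ((mul_le_mul' hKint h).trans ?_)
    rw [← ENNReal.ofReal_mul (by positivity)]
    refine ENNReal.ofReal_le_ofReal ?_
    have : 0 ≤ s ^ (Module.finrank ℝ E - β) * N := by positivity
    nlinarith
  · have h' : ∀ y, ‖v y‖ₑ ≤ ENNReal.ofReal N := fun y => by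
      rw [← ofReal_norm]; exact ENNReal.ofReal_le_ofReal (h y)
    refine (enorm_kernelConv_gradient_le hK1 hv hvc h' x).trans
      ((mul_le_mul' le_rfl hGint).trans ?_)
    rw [← ENNReal.ofReal_mul hN]
    refine ENNReal.ofReal_le_ofReal ?_
    have : 0 ≤ s ^ (Module.finrank ℝ E - β - 1) * N := by positivity
    nlinarith
  · refine (enorm_kernelConv_gradient_le' hK1 hv hvc hGsup x).trans
      ((mul_le_mul' le_rfl h).trans ?_)
    rw [← ENNReal.ofReal_mul (by positivity)]
    refine ENNReal.ofReal_le_ofReal ?_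
    have : 0 ≤ s ^ (-β - 1) * N := by positivity
    nlinarith

/-- Riesz potentials of gradients of functions that are adapted to the scale `ρ`. -/
theorem exists_atomicBound_of_scale {α : ℝ} (hn : 2 ≤ Module.finrank ℝ E) (hα0 : 0 < α)
    (hαn : α < Module.finrank ℝ E) :
    ∃ C : ℝ, 0 < C ∧ ∀ (v : E → ℝ) (N ρ : ℝ), ContDiff ℝ 1 v → HasCompactSupport v →
      0 < N → 0 < ρ → ∫⁻ x, ‖gradient v x‖ₑ ≤ ENNReal.ofReal N →
      (∀ x, |v x| ≤ N * ρ ^ (1 - (Module.finrank ℝ E : ℝ))) →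
      ∫⁻ x, ‖v x‖ₑ ≤ ENNReal.ofReal (N * ρ) →
      AtomicBound (α / Module.finrank ℝ E)
        (kernelConv (fun x => ‖x‖ ^ (-(Module.finrank ℝ E - α))) (gradient v))
        (ENNReal.ofReal (C * N)) := by
  set n : ℝ := (Module.finrank ℝ E : ℝ) with hn_def
  have hn2 : 2 ≤ n := by rw [hn_def]; exact_mod_cast hn
  set μ := α / n with hμ
  have hnμ : α = n * μ := by rw [hμ]; field_simp
  have hμ0 : 0 < μ := by positivity
  have hμ1 : μ < 1 := by rw [hμ, div_lt_one (by linarith)]; exact hαn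
  obtain ⟨c, hc, hb⟩ := exists_dyadic_bounds (E := E) (n - α)
  -- With `α = n μ`, the exponent `α - μ = (n - 1) μ` is positive because `n ≥ 2`.
  obtain ⟨C, hC, hsum⟩ := exists_tsum_min_rpow_le (a := α - μ) (b := μ) (by nlinarith) hμ0
  refine ⟨c * C, by positivity, fun v N ρ hv hvc hN hρ h1 h2 h3 => ?_⟩
  have hβ : 0 < n - α := by linarith
  refine ⟨ℤ, inferInstance,
    fun j x => ‖kernelConv (fun x => ((2 : ℝ) ^ j) ^ (-(n - α)) *
      dyadicKernel (n - α) (((2 : ℝ) ^ j)⁻¹ • x)) (gradient v) x‖ₑ,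
    fun j => c * (((2 : ℝ) ^ j) ^ α * N),
    fun j => c * min (((2 : ℝ) ^ j) ^ (α - 1) * (N * ρ ^ (1 - n)))
      (((2 : ℝ) ^ j) ^ (α - n - 1) * (N * ρ)),
    fun j => ?_, fun j => by positivity, fun j => ?_, fun j => ?_, fun j => ?_, ?_, ?_⟩
  · refine (aestronglyMeasurable_kernelConv (Continuous.aestronglyMeasurable ?_)
      (continuous_gradient hv).aestronglyMeasurable).enorm
    exact continuous_const.mul ((contDiff_dyadicKernel _).continuous.comp (by fun_prop))
  · exact mul_pos hc (lt_min (by positivity) (by positivity))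
  · have := (hb v (2 ^ j) hv hvc (by positivity)).1 N hN.le h1
    rwa [← hn_def, show n - (n - α) = α by ring] at this
  · have e1 := (hb v (2 ^ j) hv hvc (by positivity)).2.1 _ (by positivity) h2
    have e2 := (hb v (2 ^ j) hv hvc (by positivity)).2.2 _ (by positivity) h3
    rw [← hn_def, show n - (n - α) - 1 = α - 1 by ring] at e1
    rw [show -(n - α) - 1 = α - n - 1 by ring] at e2
    refine Filter.Eventually.of_forall fun x => ?_
    dsimp only
    rw [mul_min_of_nonneg _ _ hc.le, ENNReal.ofReal_min]
    exact le_min (e1 x) (e2 x)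
  · filter_upwards [ae_integrable_rpow_smul hβ (by linarith) (integrable_gradient hv hvc)] with x hx
    exact enorm_kernelConv_rpow_le_tsum hβ (continuous_gradient hv).aestronglyMeasurable hx
  · calc _ ≤ ∑' j : ℤ, ENNReal.ofReal (c * N) *
          ENNReal.ofReal (min (((2 : ℝ) ^ j / ρ) ^ (α - μ)) (((2 : ℝ) ^ j / ρ) ^ (-μ))) := by
          refine ENNReal.tsum_le_tsum fun j => ?_
          rw [← ENNReal.ofReal_mul (by positivity)]
          refine ENNReal.ofReal_le_ofReal ?_
          set s : ℝ := 2 ^ j with hs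
          have hs0 : 0 < s := by positivity
          -- The factors `c * N` occur with exponents adding up to `1`, so the interpolated size is
          -- linear in `N`. Taking `D` to be either sup bound divided by `c * N` then leaves powers
          -- of `s / ρ` alone.
          have key : ∀ D : ℝ, 0 < D → (c * (s ^ α * N)) ^ (1 - μ) * (c * (N * D)) ^ μ =
              c * N * (s ^ (α * (1 - μ)) * D ^ μ) := by
            intro D hD
            rw [show c * (s ^ α * N) = (c * N) * s ^ α by ring,
              show c * (N * D) = (c * N) * D by ring, Real.mul_rpow (y := s ^ α) (by positivity) (by positivity),
              Real.mul_rpow (y := D) (by positivity) (by positivity), ← Real.rpow_mul hs0.le]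
            have : (c * N) ^ (1 - μ) * (c * N) ^ μ = c * N := by
              rw [← Real.rpow_add (by positivity)]; simp
            calc _ = ((c * N) ^ (1 - μ) * (c * N) ^ μ) * (s ^ (α * (1 - μ)) * D ^ μ) := by ring
              _ = _ := by rw [this]
          rw [mul_min_of_nonneg _ _ (by positivity : 0 ≤ c * N)]
          refine le_min ?_ ?_
          · calc _ ≤ (c * (s ^ α * N)) ^ (1 - μ) * (c * (N * (s ^ (α - 1) * ρ ^ (1 - n)))) ^ μ := by
                  gcongr
                  dsimp only
                  gcongr
                  refine (min_le_left _ _).trans_eq ?_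
                  ring
              _ = c * N * (s ^ (α * (1 - μ)) * (s ^ (α - 1) * ρ ^ (1 - n)) ^ μ) :=
                  key _ (by positivity)
              _ = _ := by
                  congr 1
                  rw [Real.mul_rpow (by positivity) (by positivity), ← Real.rpow_mul hs0.le,
                    ← Real.rpow_mul hρ.le, ← mul_assoc, ← Real.rpow_add hs0,
                    Real.div_rpow hs0.le hρ.le, div_eq_mul_inv, ← Real.rpow_neg hρ.le]
                  congr 2
                  · ring
                  · rw [hnμ]; ring
          · calc _ ≤ (c * (s ^ α * N)) ^ (1 - μ) * (c * (N * (s ^ (α - n - 1) * ρ))) ^ μ := by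
                  gcongr
                  dsimp only
                  gcongr
                  refine (min_le_right _ _).trans_eq ?_
                  ring
              _ = c * N * (s ^ (α * (1 - μ)) * (s ^ (α - n - 1) * ρ) ^ μ) :=
                  key _ (by positivity)
              _ = _ := by
                  congr 1
                  rw [Real.mul_rpow (by positivity) (by positivity), ← Real.rpow_mul hs0.le,
                    ← mul_assoc, ← Real.rpow_add hs0,
                    Real.div_rpow hs0.le hρ.le, Real.rpow_neg hρ.le, div_inv_eq_mul]
                  congr 2
                  rw [hnμ]; ring
      _ ≤ ENNReal.ofReal (c * N) * ENNReal.ofReal C := by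
          rw [ENNReal.tsum_mul_left]; gcongr; exact hsum ρ hρ
      _ = _ := by
          rw [← ENNReal.ofReal_mul (by positivity)]; congr 1; ring

end Atom

/-! ### Smooth truncations -/

section Truncation

open Filter Topology

/-- The even function that vanishes on `[-1, 1]`, equals `1` outside `[-2, 2]` and is affine
in between. -/
noncomputable def rampWeight (s : ℝ) : ℝ := min 1 (max 0 (|s| - 1))

theorem continuous_rampWeight : Continuous rampWeight := by
  unfold rampWeight; fun_prop

theorem rampWeight_le_one (s : ℝ) : rampWeight s ≤ 1 := min_le_left _ _

theorem rampWeight_mono {s t : ℝ} (h : |s| ≤ |t|) : rampWeight s ≤ rampWeight t := by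
  unfold rampWeight; gcongr

theorem rampWeight_eq_zero {s : ℝ} (h : |s| ≤ 1) : rampWeight s = 0 := by
  rw [rampWeight, max_eq_left (by linarith)]; simp

theorem hasDerivAt_max_zero_sq (s : ℝ) : HasDerivAt (fun s : ℝ => max s 0 ^ 2) (2 * max s 0) s := by
  have hne : ∀ y : ℝ, y ≠ 0 → HasDerivAt (fun s : ℝ => max s 0 ^ 2) (2 * max y 0) y := by
    intro y hy
    rcases lt_or_gt_of_ne hy with h | h
    · have : (fun s : ℝ => max s 0 ^ 2) =ᶠ[𝓝 y] fun _ => 0 := by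
        filter_upwards [Iio_mem_nhds h] with t ht
        rw [max_eq_right (le_of_lt ht)]; norm_num
      rw [max_eq_right h.le, mul_zero]
      exact (hasDerivAt_const y (0 : ℝ)).congr_of_eventuallyEq this
    · have : (fun s : ℝ => max s 0 ^ 2) =ᶠ[𝓝 y] fun s => s ^ 2 := by
        filter_upwards [Ioi_mem_nhds h] with t ht
        rw [max_eq_left (le_of_lt ht)]
      rw [max_eq_left h.le]
      simpa using (hasDerivAt_pow 2 y).congr_of_eventuallyEq this
  rcases eq_or_ne s 0 with rfl | hs
  · exact hasDerivAt_of_hasDerivAt_of_ne (g := fun y => 2 * max y 0) hne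
      (by fun_prop) (by fun_prop)
  · exact hne s hs

/-- The odd primitive of `rampWeight`. -/
noncomputable def ramp (s : ℝ) : ℝ :=
  (max (s - 1) 0 ^ 2 - max (s - 2) 0 ^ 2 - max (-s - 1) 0 ^ 2 + max (-s - 2) 0 ^ 2) / 2

theorem hasDerivAt_ramp (s : ℝ) : HasDerivAt ramp (rampWeight s) s := by
  have h1 : ∀ c : ℝ, HasDerivAt (fun s : ℝ => max (s - c) 0 ^ 2) (2 * max (s - c) 0) s := fun c =>
    (hasDerivAt_max_zero_sq (s - c)).comp_sub_const s c
  have h2 : ∀ c : ℝ, HasDerivAt (fun s : ℝ => max (-s - c) 0 ^ 2) (-(2 * max (-s - c) 0)) s := by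
    intro c
    have := (hasDerivAt_max_zero_sq (-s - c)).comp s ((hasDerivAt_neg s).sub_const c)
    simpa [Function.comp_def] using this
  have h := ((((h1 1).sub (h1 2)).sub (h2 1)).add (h2 2)).div_const 2
  refine h.congr_deriv ?_
  unfold rampWeight
  grind

theorem ramp_neg (s : ℝ) : ramp (-s) = -ramp s := by
  unfold ramp; ring_nf

theorem ramp_eq_zero {s : ℝ} (h : |s| ≤ 1) : ramp s = 0 := by
  obtain ⟨h1, h2⟩ := abs_le.1 h
  rw [ramp, max_eq_right (by linarith), max_eq_right (by linarith), max_eq_right (by linarith),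
    max_eq_right (by linarith)]
  norm_num

/-- For `s ≥ 0` the ramp is `0` up to `1`, `(s - 1)² / 2` up to `2`, and `s - 3/2` afterwards. It is
a `C¹` substitute for a hinge function, so truncations of `C¹` functions remain `C¹`. -/
theorem ramp_bounds {s : ℝ} (hs : 0 ≤ s) :
    max 0 (s - 3 / 2) ≤ ramp s ∧ ramp s ≤ max 0 (s - 1) := by
  rw [ramp, max_eq_right (show -s - 1 ≤ 0 by linarith), max_eq_right (show -s - 2 ≤ 0 by linarith)]
  rcases le_total s 1 with h1 | h1
  · rw [max_eq_right (show s - 1 ≤ 0 by linarith), max_eq_right (show s - 2 ≤ 0 by linarith),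
      max_eq_left (show s - 3 / 2 ≤ 0 by linarith), max_eq_left (show s - 1 ≤ 0 by linarith)]
    norm_num
  · rcases le_total s 2 with h2 | h2
    · rw [max_eq_left (show 0 ≤ s - 1 by linarith), max_eq_right (show s - 2 ≤ 0 by linarith),
        max_eq_right (show 0 ≤ s - 1 by linarith)]
      refine ⟨max_le (by nlinarith) (by nlinarith), by nlinarith⟩
    · rw [max_eq_left (show 0 ≤ s - 1 by linarith), max_eq_left (show 0 ≤ s - 2 by linarith),
        max_eq_right (show 0 ≤ s - 1 by linarith), max_eq_right (show 0 ≤ s - 3 / 2 by linarith)]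
      constructor <;> nlinarith

/-- The ramp at height `a`. -/
noncomputable def rampAt (a s : ℝ) : ℝ := a * ramp (s / a)

theorem hasDerivAt_rampAt {a : ℝ} (ha : 0 < a) (s : ℝ) :
    HasDerivAt (rampAt a) (rampWeight (s / a)) s := by
  have := ((hasDerivAt_ramp (s / a)).comp s ((hasDerivAt_id s).div_const a)).const_mul a
  refine this.congr_deriv ?_
  field_simp

theorem rampAt_neg (a s : ℝ) : rampAt a (-s) = -rampAt a s := by
  rw [rampAt, neg_div, ramp_neg, rampAt, mul_neg]

theorem rampAt_eq_zero {a s : ℝ} (ha : 0 < a) (h : |s| ≤ a) : rampAt a s = 0 := by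
  rw [rampAt, ramp_eq_zero, mul_zero]
  rw [abs_div, abs_of_pos ha]
  exact (div_le_one ha).2 h

theorem rampAt_bounds {a s : ℝ} (ha : 0 < a) (hs : 0 ≤ s) :
    max 0 (s - 3 / 2 * a) ≤ rampAt a s ∧ rampAt a s ≤ max 0 (s - a) := by
  obtain ⟨h1, h2⟩ := ramp_bounds (show 0 ≤ s / a by positivity)
  have e : a * (s / a) = s := by field_simp
  constructor
  · calc max 0 (s - 3 / 2 * a) = a * max 0 (s / a - 3 / 2) := by
          rw [mul_max_of_nonneg _ _ ha.le, mul_sub, e]; ring_nf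
      _ ≤ _ := by rw [rampAt]; gcongr
  · calc rampAt a s ≤ a * max 0 (s / a - 1) := by rw [rampAt]; gcongr
      _ = _ := by rw [mul_max_of_nonneg _ _ ha.le, mul_sub, e]; ring_nf

theorem abs_sub_rampAt_le {a : ℝ} (ha : 0 < a) (s : ℝ) : |s - rampAt a s| ≤ 2 * a := by
  have key : ∀ s : ℝ, 0 ≤ s → |s - rampAt a s| ≤ 2 * a := by
    intro s hs
    obtain ⟨h1, h2⟩ := rampAt_bounds ha hs
    have h3 : max 0 (s - a) ≤ s := max_le hs (by linarith)
    have h4 := (le_max_right _ _).trans h1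
    rw [abs_le]; constructor <;> linarith
  rcases le_total 0 s with h | h
  · exact key s h
  · have := key (-s) (by linarith)
    rw [rampAt_neg] at this
    rwa [show s - rampAt a s = -(-s - -rampAt a s) by ring, abs_neg]

theorem abs_rampAt_sub_rampAt_le {a : ℝ} (ha : 0 < a) (s : ℝ) :
    |rampAt a s - rampAt (2 * a) s| ≤ 2 * a := by
  have key : ∀ s : ℝ, 0 ≤ s → |rampAt a s - rampAt (2 * a) s| ≤ 2 * a := by
    intro s hs
    obtain ⟨h1, h2⟩ := rampAt_bounds ha hs
    obtain ⟨h3, h4⟩ := rampAt_bounds (show 0 < 2 * a by linarith) hs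
    rw [abs_le]
    have h5 : max 0 (s - a) ≤ max 0 (s - 3 / 2 * (2 * a)) + 2 * a :=
      max_le (by positivity) (by linarith [le_max_right 0 (s - 3 / 2 * (2 * a))])
    have h6 : max 0 (s - 2 * a) ≤ max 0 (s - 3 / 2 * a) + 2 * a :=
      max_le (by positivity) (by linarith [le_max_right 0 (s - 3 / 2 * a)])
    constructor <;> linarith
  rcases le_total 0 s with h | h
  · exact key s h
  · have := key (-s) (by linarith)
    rw [rampAt_neg, rampAt_neg] at this
    rwa [show rampAt a s - rampAt (2 * a) s = -(-rampAt a s - -rampAt (2 * a) s) by ring, abs_neg]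

/-- Above height `2a` one ramp is at least `|s| - 3a/2` and the other at most `|s| - 2a`. Thus a
superlevel set of `u` can be detected from a single truncation piece, and its volume is controlled
by the gradient of that piece alone. -/
theorem le_abs_rampAt_sub_rampAt {a s : ℝ} (ha : 0 < a) (hs : 2 * a ≤ |s|) :
    a / 2 ≤ |rampAt a s - rampAt (2 * a) s| := by
  have key : ∀ s : ℝ, 2 * a ≤ s → a / 2 ≤ |rampAt a s - rampAt (2 * a) s| := by
    intro s hs
    have h0 : 0 ≤ s := by linarith
    obtain ⟨h1, h2⟩ := rampAt_bounds ha h0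
    obtain ⟨h3, h4⟩ := rampAt_bounds (show 0 < 2 * a by linarith) h0
    refine le_trans ?_ (le_abs_self _)
    rw [max_eq_right (by linarith)] at h4
    have := (le_max_right _ _).trans h1
    linarith
  rcases le_total 0 s with h | h
  · exact key s (by rwa [abs_of_nonneg h] at hs)
  · have := key (-s) (by rwa [abs_of_nonpos h] at hs)
    rw [rampAt_neg, rampAt_neg] at this
    rwa [show rampAt a s - rampAt (2 * a) s = -(-rampAt a s - -rampAt (2 * a) s) by ring, abs_neg]

/-- The dyadic decomposition of the identity of `ℝ`, with lowest height `ε`. -/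
noncomputable def dyadicTrunc (ε : ℝ) : ℕ → ℝ → ℝ
  | 0, s => s - rampAt ε s
  | m + 1, s => rampAt (ε * 2 ^ m) s - rampAt (2 * (ε * 2 ^ m)) s

/-- The derivatives of `dyadicTrunc`. -/
noncomputable def dyadicWeight (ε : ℝ) : ℕ → ℝ → ℝ
  | 0, s => 1 - rampWeight (s / ε)
  | m + 1, s => rampWeight (s / (ε * 2 ^ m)) - rampWeight (s / (2 * (ε * 2 ^ m)))

theorem hasDerivAt_dyadicTrunc {ε : ℝ} (hε : 0 < ε) (m : ℕ) (s : ℝ) :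
    HasDerivAt (dyadicTrunc ε m) (dyadicWeight ε m s) s := by
  cases m with
  | zero => exact (hasDerivAt_id s).sub (hasDerivAt_rampAt hε s)
  | succ m => exact (hasDerivAt_rampAt (by positivity) s).sub (hasDerivAt_rampAt (by positivity) s)

theorem continuous_dyadicWeight (ε : ℝ) (m : ℕ) : Continuous (dyadicWeight ε m) := by
  have h : ∀ c : ℝ, Continuous fun s : ℝ => rampWeight (s / c) := fun c =>
    continuous_rampWeight.comp (continuous_id.div_const c)
  cases m with
  | zero => exact continuous_const.sub (h _)
  | succ m => exact (h _).sub (h _)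

theorem dyadicWeight_nonneg {ε : ℝ} (hε : 0 < ε) (m : ℕ) (s : ℝ) : 0 ≤ dyadicWeight ε m s := by
  cases m with
  | zero => exact sub_nonneg.2 (rampWeight_le_one _)
  | succ m =>
    refine sub_nonneg.2 (rampWeight_mono ?_)
    have : 0 < ε * 2 ^ m := by positivity
    rw [abs_div, abs_div, abs_of_pos this, abs_of_pos (by positivity : 0 < 2 * (ε * 2 ^ m))]
    exact div_le_div_of_nonneg_left (abs_nonneg _) this (by linarith)

theorem dyadicTrunc_zero {ε : ℝ} (hε : 0 < ε) (m : ℕ) : dyadicTrunc ε m 0 = 0 := by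
  have h : ∀ a : ℝ, 0 < a → rampAt a 0 = 0 := fun a ha => rampAt_eq_zero ha (by simpa using ha.le)
  cases m with
  | zero => simp [dyadicTrunc, h ε hε]
  | succ m =>
    simp [dyadicTrunc, h (ε * 2 ^ m) (by positivity), h (2 * (ε * 2 ^ m)) (by positivity)]

/-- The partial sums telescope to `1 - rampWeight (s / (ε 2^m))`, which is `1` once `ε 2^m ≥ |s|`.
Together with nonnegativity this makes the gradient masses of the pieces add up exactly to that of
`u`. -/
theorem hasSum_dyadicWeight {ε : ℝ} (hε : 0 < ε) (s : ℝ) :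
    HasSum (fun m => dyadicWeight ε m s) 1 := by
  rw [hasSum_iff_tendsto_nat_of_nonneg (fun m => dyadicWeight_nonneg hε m s)]
  have hsum : ∀ m : ℕ, ∑ i ∈ Finset.range (m + 1), dyadicWeight ε i s =
      1 - rampWeight (s / (ε * 2 ^ m)) := by
    intro m
    induction m with
    | zero => simp [dyadicWeight]
    | succ m ih =>
      rw [Finset.sum_range_succ, ih, dyadicWeight,
        show 2 * (ε * 2 ^ m) = ε * 2 ^ (m + 1) by ring]
      ring
  rw [← tendsto_add_atTop_iff_nat 1]
  simp_rw [hsum]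
  refine tendsto_const_nhds.congr' ?_
  have h1 : Tendsto (fun m : ℕ => ε * (2 : ℝ) ^ m) atTop atTop :=
    (tendsto_pow_atTop_atTop_of_one_lt one_lt_two).const_mul_atTop hε
  filter_upwards [h1.eventually_ge_atTop |s|] with m hm
  rw [rampWeight_eq_zero, sub_zero]
  have : 0 < ε * 2 ^ m := by positivity
  rw [abs_div, abs_of_pos this]
  exact (div_le_one this).2 hm

end Truncation

/-! ### Riesz potentials of gradients of compactly supported functions -/

section CompactSupport

open Filter Topology

variable {E : Type*} [NormedAddCommGroup E] [InnerProductSpace ℝ E] [FiniteDimensional ℝ E]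

theorem gradient_comp_of_hasDerivAt {φ w : ℝ → ℝ} (hφ : ∀ s, HasDerivAt φ (w s) s)
    {u : E → ℝ} (hu : ContDiff ℝ 1 u) (x : E) :
    gradient (fun x => φ (u x)) x = w (u x) • gradient u x := by
  have h1 := (hu.differentiable (by simp) x).hasFDerivAt
  refine HasGradientAt.gradient ?_
  rw [hasGradientAt_iff_hasFDerivAt]
  refine ((hφ (u x)).comp_hasFDerivAt x h1).congr_fderiv ?_
  rw [map_smul, toDual_gradient]

theorem contDiff_one_of_hasDerivAt {φ w : ℝ → ℝ} (hφ : ∀ s, HasDerivAt φ (w s) s)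
    (hw : Continuous w) : ContDiff ℝ 1 φ := by
  rw [contDiff_one_iff_deriv]
  refine ⟨fun s => (hφ s).differentiableAt, ?_⟩
  rwa [show deriv φ = w from funext fun s => (hφ s).deriv]

variable [MeasurableSpace E] [BorelSpace E]

/-- A weak-type form of the Gagliardo–Nirenberg–Sobolev inequality. -/
theorem exists_volume_le_of_gradient (hn : 2 ≤ Module.finrank ℝ E) :
    ∃ c : ℝ, 0 < c ∧ ∀ (f : E → ℝ) (b τ : ℝ), ContDiff ℝ 1 f → HasCompactSupport f → 0 ≤ b →
      0 < τ → ∫⁻ x, ‖gradient f x‖ₑ ≤ ENNReal.ofReal b →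
      volume {x | τ ≤ |f x|} ≤
        ENNReal.ofReal (c * (b / τ) ^ ((Module.finrank ℝ E : ℝ) / (Module.finrank ℝ E - 1))) := by
  set n := Module.finrank ℝ E with hn_def
  have hn1 : (1 : ℝ) < n := by exact_mod_cast (by lia : 1 < n)
  set p : ℝ := n / (n - 1) with hp
  have hp0 : 0 < p := div_pos (by linarith) (by linarith)
  have hconj : NNReal.HolderConjugate (n : ℝ≥0) p.toNNReal := by
    rw [← NNReal.holderConjugate_coe_iff, Real.coe_toNNReal _ hp0.le]
    exact Real.HolderConjugate.conjExponent hn1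
  set K := eLpNormLESNormFDerivOneConst (volume : Measure E) p.toNNReal
  -- Chebyshev's inequality in `L^p` applied to the Sobolev bound; adding `1` to `K` only keeps the
  -- constant positive.
  refine ⟨((K : ℝ) + 1) ^ p, by positivity, fun f b τ hf hfc hb hτ hfb => ?_⟩
  have hG := eLpNorm_le_eLpNorm_fderiv_one (volume : Measure E) hf hfc hconj
  have hG' : eLpNorm f (ENNReal.ofReal p) volume ≤ ENNReal.ofReal (((K : ℝ) + 1) * b) := by
    refine hG.trans ?_
    rw [eLpNorm_one_eq_lintegral_enorm, ENNReal.ofReal_mul (by positivity)]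
    gcongr
    · rw [← ENNReal.ofReal_coe_nnreal]
      exact ENNReal.ofReal_le_ofReal (by linarith)
    · simpa only [enorm_gradient] using hfb
  have hM := meas_ge_le_mul_pow_eLpNorm_enorm (volume : Measure E) (p := ENNReal.ofReal p)
    (by simpa using hp0) ENNReal.ofReal_ne_top hf.continuous.aestronglyMeasurable
    (ε := ENNReal.ofReal τ) (by simpa using hτ) (by simp)
  have hset : {x | τ ≤ |f x|} = {x | ENNReal.ofReal τ ≤ ‖f x‖ₑ} := by
    ext x
    rw [mem_ofPred_eq, mem_ofPred_eq, ← ofReal_norm, ENNReal.ofReal_le_ofReal_iff (norm_nonneg _)]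
    rfl
  rw [hset]
  refine hM.trans ?_
  rw [ENNReal.toReal_ofReal hp0.le, ← ENNReal.mul_rpow_of_nonneg _ _ hp0.le]
  calc ((ENNReal.ofReal τ)⁻¹ * eLpNorm f (ENNReal.ofReal p) volume) ^ p
      ≤ (ENNReal.ofReal τ⁻¹ * ENNReal.ofReal (((K : ℝ) + 1) * b)) ^ p := by
        rw [ENNReal.ofReal_inv_of_pos hτ]
        gcongr
    _ = _ := by
        rw [← ENNReal.ofReal_mul (by positivity), ENNReal.ofReal_rpow_of_nonneg (by positivity) hp0.le,
          ← Real.mul_rpow (by positivity) (by positivity)]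
        congr 2
        field_simp

/-- Choose `ρ` with `N ρ^{1-n} = a`. The volume hypothesis then reads `|S| ≤ c₀ (N / a) ρ`, whence
`‖v‖₁ ≤ 2a |S| ≤ 2 c₀ N ρ`, and `v` is adapted to the scale `ρ`. -/
theorem exists_atomicBound_of_volume_le {α : ℝ} (hn : 2 ≤ Module.finrank ℝ E) (hα0 : 0 < α)
    (hαn : α < Module.finrank ℝ E) {c₀ : ℝ} (hc₀ : 0 < c₀) :
    ∃ C : ℝ, 0 < C ∧ ∀ (v : E → ℝ) (N a : ℝ) (S : Set E), ContDiff ℝ 1 v → HasCompactSupport v →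
      0 < N → 0 < a → MeasurableSet S → ∫⁻ x, ‖gradient v x‖ₑ ≤ ENNReal.ofReal N →
      (∀ x, |v x| ≤ 2 * a) → (∀ x, x ∉ S → v x = 0) →
      volume S ≤ ENNReal.ofReal
        (c₀ * (N / a) ^ ((Module.finrank ℝ E : ℝ) / (Module.finrank ℝ E - 1))) →
      AtomicBound (α / Module.finrank ℝ E)
        (kernelConv (fun x => ‖x‖ ^ (-(Module.finrank ℝ E - α))) (gradient v))
        (ENNReal.ofReal (C * N)) := by
  obtain ⟨C, hC, h⟩ := exists_atomicBound_of_scale (E := E) hn hα0 hαn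
  set n : ℝ := (Module.finrank ℝ E : ℝ) with hn_def
  have hn2 : 2 ≤ n := by rw [hn_def]; exact_mod_cast hn
  have hn1 : 0 < n - 1 := by linarith
  -- Replacing `N` by `(2 + 2 c₀) N` absorbs both the `2` of the sup bound and the `2 c₀` of the
  -- `L¹` bound.
  refine ⟨C * (2 + 2 * c₀), by positivity, fun v N a S hv hvc hN ha hS h1 h2 h3 h4 => ?_⟩
  set ρ := (N / a) ^ (1 / (n - 1)) with hρ
  have hNa : 0 < N / a := by positivity
  have hρ0 : 0 < ρ := by positivity
  have hρ1 : ρ ^ (1 - n) = a / N := by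
    rw [hρ, ← Real.rpow_mul hNa.le, show 1 / (n - 1) * (1 - n) = -1 by field_simp; ring,
      Real.rpow_neg_one, inv_div]
  have hρ2 : (N / a) ^ (n / (n - 1)) = N / a * ρ := by
    rw [hρ, show n / (n - 1) = 1 + 1 / (n - 1) by field_simp; ring, Real.rpow_add hNa,
      Real.rpow_one]
  rw [mul_assoc]
  refine h v ((2 + 2 * c₀) * N) ρ hv hvc (by positivity) hρ0 (h1.trans ?_) (fun x => ?_) ?_
  · refine ENNReal.ofReal_le_ofReal ?_
    nlinarith
  · rw [hρ1]
    refine (h2 x).trans ?_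
    rw [show (2 + 2 * c₀) * N * (a / N) = (2 + 2 * c₀) * a by field_simp]
    nlinarith
  · calc ∫⁻ x, ‖v x‖ₑ ≤ ∫⁻ x, S.indicator (fun _ => ENNReal.ofReal (2 * a)) x := by
          refine lintegral_mono fun x => ?_
          by_cases hx : x ∈ S
          · rw [indicator_of_mem hx, ← ofReal_norm]
            exact ENNReal.ofReal_le_ofReal (h2 x)
          · simp [hx, h3 x hx]
      _ = ENNReal.ofReal (2 * a) * volume S := by rw [lintegral_indicator_const hS]
      _ ≤ ENNReal.ofReal (2 * a) * ENNReal.ofReal (c₀ * (N / a * ρ)) := by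
          rw [← hρ2]; gcongr
      _ ≤ _ := by
          rw [← ENNReal.ofReal_mul (by positivity)]
          refine ENNReal.ofReal_le_ofReal ?_
          rw [show 2 * a * (c₀ * (N / a * ρ)) = 2 * c₀ * N * ρ by field_simp]
          gcongr
          linarith

theorem enorm_kernelConv_le_tsum_of_hasSum {V : Type*} [NormedAddCommGroup V] [NormedSpace ℝ V]
    {K : E → ℝ} {G : E → V} {w : ℕ → E → ℝ} (hw : ∀ m, Measurable (w m)) (hw0 : ∀ m y, 0 ≤ w m y)
    (hsum : ∀ y, HasSum (fun m => w m y) 1) {x : E} (hx : Integrable fun y => K (x - y) • G y) :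
    ‖kernelConv K G x‖ₑ ≤ ∑' m, ‖kernelConv K (fun y => w m y • G y) x‖ₑ := by
  have h := hasSum_integral_of_dominated_convergence (μ := (volume : Measure E))
    (F := fun (m : ℕ) y => K (x - y) • w m y • G y)
    (f := fun y => K (x - y) • G y)
    (fun m y => w m y * ‖K (x - y) • G y‖)
    (fun m => ?_) (fun m => ?_) ?_ ?_ ?_
  · have hs := h.tsum_eq
    simp only [kernelConv]
    rw [← hs]
    exact enorm_tsum_le_tsum_enorm
  · simp_rw [smul_comm (K _) (w m _)]
    exact (hw m).aestronglyMeasurable.smul hx.1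
  · refine Eventually.of_forall fun y => le_of_eq ?_
    rw [smul_comm, norm_smul, Real.norm_of_nonneg (hw0 m y)]
  · exact Eventually.of_forall fun y => (hsum y).summable.mul_right _
  · refine hx.norm.congr (Eventually.of_forall fun y => ?_)
    simp only
    rw [tsum_mul_right, (hsum y).tsum_eq, one_mul]
  · refine Eventually.of_forall fun y => ?_
    have := (hsum y).smul_const (K (x - y) • G y)
    simpa only [one_smul, smul_comm (K (x - y))] using this

/-- With truncated subtraction the term `b 0` occurs twice, at `m = 0` and `m = 1`. -/
theorem tsum_pred_le (b : ℕ → ℝ≥0∞) : ∑' m, b (m - 1) ≤ 2 * ∑' m, b m := by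
  have h : ∑' m, b (m - 1) = b (0 - 1) + ∑' m, b (m + 1 - 1) :=
    tsum_eq_zero_add' (f := fun m => b (m - 1)) ENNReal.summable
  rw [h, two_mul]
  exact add_le_add (ENNReal.le_tsum _) le_rfl

/-- The Riesz potential of the gradient of a compactly supported function. -/
theorem exists_atomicBound_gradient {α : ℝ} (hn : 2 ≤ Module.finrank ℝ E) (hα0 : 0 < α)
    (hαn : α < Module.finrank ℝ E) :
    ∃ C : ℝ, 0 < C ∧ ∀ u : E → ℝ, ContDiff ℝ 1 u → HasCompactSupport u →
      AtomicBound (α / Module.finrank ℝ E)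
        (kernelConv (fun x => ‖x‖ ^ (-(Module.finrank ℝ E - α))) (gradient u))
        (ENNReal.ofReal C * ∫⁻ x, ‖gradient u x‖ₑ) := by
  obtain ⟨cG, hcG, hGNS⟩ := exists_volume_le_of_gradient (E := E) hn
  set n : ℝ := (Module.finrank ℝ E : ℝ) with hn_def
  have hn2 : 2 ≤ n := by rw [hn_def]; exact_mod_cast hn
  set p : ℝ := n / (n - 1) with hp
  have hp1 : 1 ≤ p := by rw [hp, le_div_iff₀ (by linarith)]; linarith
  -- The summand `1` serves the bottom piece; `4 ^ p` comes from testing the other superlevel sets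
  -- at height `a / 4`.
  obtain ⟨C, hC, hatom⟩ := exists_atomicBound_of_volume_le (E := E) hn hα0 hαn
    (c₀ := 1 + cG * 4 ^ p) (by positivity)
  refine ⟨C * 10, by positivity, fun u hu huc => ?_⟩
  have hgi := integrable_gradient hu huc
  set N₀ : ℝ := (∫⁻ x, ‖gradient u x‖ₑ).toReal with hN₀
  have hN₀' : ∫⁻ x, ‖gradient u x‖ₑ = ENNReal.ofReal N₀ := by
    rw [hN₀, ENNReal.ofReal_toReal hgi.2.ne]
  rcases (ENNReal.toReal_nonneg : 0 ≤ N₀).eq_or_lt with h0 | hpos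
  · refine AtomicBound.of_ae_eq_zero (Eventually.of_forall fun x => ?_)
    have : ∫⁻ x, ‖gradient u x‖ₑ = 0 := by
      rw [hN₀', show N₀ = 0 from h0.symm, ENNReal.ofReal_zero]
    rw [lintegral_eq_zero_iff (continuous_gradient hu).enorm.measurable] at this
    rw [kernelConv, Pi.zero_apply]
    refine integral_eq_zero_of_ae ?_
    filter_upwards [this] with y hy
    have : gradient u y = 0 := by simpa using hy
    simp [this]
  set Vol : ℝ := (volume (tsupport u)).toReal with hVol
  have hVol0 : 0 ≤ Vol := ENNReal.toReal_nonneg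
  have hVol' : volume (tsupport u) = ENNReal.ofReal Vol := by
    rw [hVol, ENNReal.ofReal_toReal huc.measure_lt_top.ne]
  -- The bottom piece has no piece beneath it to control its support. This `ε` is so small that the
  -- whole support of `u` satisfies the required bound: `Vol ≤ N₀ / ε`.
  set ε : ℝ := N₀ / (1 + Vol) with hε_def
  have hε : 0 < ε := by positivity
  set v : ℕ → E → ℝ := fun m x => dyadicTrunc ε m (u x) with hv_def
  have hv1 : ∀ m, ContDiff ℝ 1 (v m) := fun m =>
    (contDiff_one_of_hasDerivAt (hasDerivAt_dyadicTrunc hε m) (continuous_dyadicWeight ε m)).comp hu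
  have hvc : ∀ m, HasCompactSupport (v m) := fun m =>
    huc.comp_left (g := dyadicTrunc ε m) (dyadicTrunc_zero hε m)
  have hgv : ∀ m x, gradient (v m) x = dyadicWeight ε m (u x) • gradient u x := fun m x =>
    gradient_comp_of_hasDerivAt (hasDerivAt_dyadicTrunc hε m) hu x
  set b : ℕ → ℝ≥0∞ := fun m => ∫⁻ x, ‖gradient (v m) x‖ₑ with hb_def
  have hbsum : ∑' m, b m = ENNReal.ofReal N₀ := by
    rw [← hN₀', hb_def, ← lintegral_tsum
      fun m => (continuous_gradient (hv1 m)).enorm.measurable.aemeasurable]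
    refine lintegral_congr fun x => ?_
    have hs := hasSum_dyadicWeight hε (u x)
    simp_rw [hgv, enorm_smul, Real.enorm_of_nonneg (dyadicWeight_nonneg hε _ _)]
    rw [ENNReal.tsum_mul_right, ← ENNReal.ofReal_tsum_of_nonneg
      (fun m => dyadicWeight_nonneg hε m _) hs.summable, hs.tsum_eq, ENNReal.ofReal_one, one_mul]
  have hbtop : ∀ m, b m ≠ ⊤ := fun m =>
    ne_top_of_le_ne_top ENNReal.ofReal_ne_top (hbsum ▸ ENNReal.le_tsum m)
  have hbm : ∀ m, ENNReal.ofReal (b m).toReal = b m := fun m => ENNReal.ofReal_toReal (hbtop m)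
  -- The last term controls the support of the `m`-th piece, the middle one its gradient. The
  -- geometric term keeps `M m` positive and ensures `N₀ ≤ 2 M m` for `m = 0, 1`, at a total cost of
  -- `2 N₀`.
  set M : ℕ → ℝ := fun m => N₀ * (1 / 2) ^ m + (b m).toReal + (b (m - 1)).toReal with hM_def
  have hM0 : ∀ m, 0 < M m := fun m => by
    have : 0 ≤ (b m).toReal := ENNReal.toReal_nonneg
    have : 0 ≤ (b (m - 1)).toReal := ENNReal.toReal_nonneg
    have : 0 < N₀ * (1 / 2) ^ m := by positivity
    simp only [hM_def]; linarith
  have hbM : ∀ m, b m ≤ ENNReal.ofReal (M m) := fun m => by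
    rw [← hbm m]
    refine ENNReal.ofReal_le_ofReal ?_
    have : 0 ≤ (b (m - 1)).toReal := ENNReal.toReal_nonneg
    have : 0 < N₀ * (1 / 2) ^ m := by positivity
    simp only [hM_def]; linarith
  have hpiece : ∀ m, AtomicBound (α / n) (kernelConv (fun x => ‖x‖ ^ (-(n - α))) (gradient (v m)))
      (ENNReal.ofReal (C * (2 * M m))) := by
    intro m
    have h2M : 0 < 2 * M m := by linarith [hM0 m]
    have hb2 : b m ≤ ENNReal.ofReal (2 * M m) := (hbM m).trans
      (ENNReal.ofReal_le_ofReal (by linarith [hM0 m]))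
    cases m with
    | zero =>
      refine hatom (v 0) _ ε (tsupport u) (hv1 0) (hvc 0) h2M hε (isClosed_tsupport u).measurableSet
        hb2 (fun x => abs_sub_rampAt_le hε _) (fun x hx => ?_) ?_
      · simp only [hv_def, image_eq_zero_of_notMem_tsupport hx, dyadicTrunc_zero hε]
      · rw [hVol']
        refine ENNReal.ofReal_le_ofReal ?_
        have h1 : 1 + Vol ≤ 2 * M 0 / ε := by
          rw [le_div_iff₀ hε, hε_def, mul_div_cancel₀ _ (by positivity)]
          have : N₀ ≤ M 0 := by
            have : 0 ≤ (b 0).toReal := ENNReal.toReal_nonneg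
            simp only [hM_def]; simp; linarith
          linarith
        have h2 : 1 + Vol ≤ (2 * M 0 / ε) ^ p := by
          calc 1 + Vol ≤ 2 * M 0 / ε := h1
            _ = (2 * M 0 / ε) ^ (1 : ℝ) := (Real.rpow_one _).symm
            _ ≤ _ := Real.rpow_le_rpow_of_exponent_le (by linarith) hp1
        have h3 : 0 ≤ cG * 4 ^ p := by positivity
        nlinarith
    | succ m =>
      set a : ℝ := ε * 2 ^ m with ha_def
      have ha : 0 < a := by positivity
      have hvol : volume {x | a ≤ |u x|} ≤
          ENNReal.ofReal (cG * (2 * M (m + 1) / (a / 4)) ^ p) := by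
        cases m with
        | zero =>
          -- The piece beneath is the bottom one, for which no lower bound is available; the Sobolev
          -- bound is applied to `u` itself, using `N₀ ≤ 2 M 1`.
          have hsub : {x | a ≤ |u x|} ⊆ {x | a / 4 ≤ |u x|} := fun x (hx : a ≤ |u x|) =>
            show a / 4 ≤ |u x| by linarith
          refine (measure_mono hsub).trans
            (hGNS u _ (a / 4) hu huc h2M.le (by positivity) ?_)
          rw [hN₀']
          refine ENNReal.ofReal_le_ofReal ?_
          have : 0 ≤ (b (0 + 1)).toReal := ENNReal.toReal_nonneg
          have : 0 ≤ (b (0 + 1 - 1)).toReal := ENNReal.toReal_nonneg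
          simp only [hM_def]; linarith
        | succ m =>
          have hsub : {x | a ≤ |u x|} ⊆ {x | a / 4 ≤ |v (m + 1) x|} := by
            intro x (hx : a ≤ |u x|)
            -- The preceding piece lives at level `a / 2`, so it is at least `a / 4` wherever `|u| ≥
            -- a`.
            have ha2 : a = 2 * (ε * 2 ^ m) := by rw [ha_def]; ring
            have := le_abs_rampAt_sub_rampAt (show 0 < ε * 2 ^ m by positivity) (ha2 ▸ hx)
            change a / 4 ≤ |v (m + 1) x|
            refine le_trans (le_of_eq ?_) this
            rw [ha2]; ring
          refine (measure_mono hsub).trans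
            (hGNS (v (m + 1)) _ (a / 4) (hv1 _) (hvc _) h2M.le (by positivity) ?_)
          change b (m + 1) ≤ _
          rw [← hbm (m + 1)]
          refine ENNReal.ofReal_le_ofReal ?_
          have h1 : 0 ≤ (b (m + 1 + 1)).toReal := ENNReal.toReal_nonneg
          have h2 : 0 ≤ (b (m + 1)).toReal := ENNReal.toReal_nonneg
          have h3 : 0 < N₀ * (1 / 2) ^ (m + 1 + 1) := by positivity
          simp only [hM_def, Nat.add_sub_cancel]; linarith
      refine hatom (v (m + 1)) _ a {x | a ≤ |u x|} (hv1 _) (hvc _) h2M ha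
        (measurableSet_le measurable_const hu.continuous.abs.measurable) hb2
        (fun x => abs_rampAt_sub_rampAt_le ha _) (fun x hx => ?_) (hvol.trans ?_)
      · have hx' : |u x| ≤ a := (not_le.1 hx).le
        simp only [hv_def, dyadicTrunc]
        rw [rampAt_eq_zero ha hx', rampAt_eq_zero (by positivity) (by linarith), sub_zero]
      · refine ENNReal.ofReal_le_ofReal ?_
        rw [show 2 * M (m + 1) / (a / 4) = 4 * (2 * M (m + 1) / a) by field_simp,
          Real.mul_rpow (by norm_num) (by positivity)]
        have : 0 ≤ (2 * M (m + 1) / a) ^ p := by positivity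
        nlinarith
  have hsum : AtomicBound (α / n) (kernelConv (fun x => ‖x‖ ^ (-(n - α))) (gradient u))
      (∑' m, ENNReal.ofReal (C * (2 * M m))) := by
    refine AtomicBound.tsum hpiece ?_
    filter_upwards [ae_integrable_rpow_smul (show 0 < n - α by linarith)
      (show n - α < n by linarith) hgi] with x hx
    have := enorm_kernelConv_le_tsum_of_hasSum (K := fun x => ‖x‖ ^ (-(n - α)))
      (w := fun m y => dyadicWeight ε m (u y))
      (fun m => ((continuous_dyadicWeight ε m).comp hu.continuous).measurable)
      (fun m y => dyadicWeight_nonneg hε m _) (fun y => hasSum_dyadicWeight hε _) hx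
    simp_rw [← hgv] at this
    exact this
  refine hsum.mono ?_
  have hgeo : ∑' m : ℕ, ENNReal.ofReal (N₀ * (1 / 2) ^ m) = ENNReal.ofReal (2 * N₀) := by
    rw [← ENNReal.ofReal_tsum_of_nonneg (fun m => by positivity)
      (summable_geometric_two.mul_left N₀), tsum_mul_left, tsum_geometric_two, mul_comm]
  have hshift : ∑' m : ℕ, b (m - 1) ≤ 2 * ENNReal.ofReal N₀ := by
    rw [← hbsum]; exact tsum_pred_le b
  -- The three parts of `M` sum to at most `2 N₀`, `N₀` and `2 N₀`, and the doubling gives the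
  -- factor `10`.
  calc ∑' m, ENNReal.ofReal (C * (2 * M m))
      = ENNReal.ofReal (C * 2) * ∑' m, (ENNReal.ofReal (N₀ * (1 / 2) ^ m) + b m + b (m - 1)) := by
        rw [← ENNReal.tsum_mul_left]
        refine tsum_congr fun m => ?_
        rw [← mul_assoc, ENNReal.ofReal_mul (by positivity)]
        congr 1
        simp only [hM_def]
        rw [ENNReal.ofReal_add (by positivity) ENNReal.toReal_nonneg,
          ENNReal.ofReal_add (by positivity) ENNReal.toReal_nonneg, hbm, hbm]
    _ ≤ ENNReal.ofReal (C * 2) * (ENNReal.ofReal (2 * N₀) + ENNReal.ofReal N₀ +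
          2 * ENNReal.ofReal N₀) := by
        rw [ENNReal.tsum_add, ENNReal.tsum_add, hgeo, hbsum]
        gcongr
    _ ≤ _ := by
        rw [hN₀', show (2 : ℝ≥0∞) = ENNReal.ofReal 2 by simp, ← ENNReal.ofReal_mul (by norm_num),
          ← ENNReal.ofReal_add (by positivity) (by positivity),
          ← ENNReal.ofReal_add (by positivity) (by positivity), ← ENNReal.ofReal_mul (by positivity),
          ← ENNReal.ofReal_mul (by positivity)]
        refine ENNReal.ofReal_le_ofReal (le_of_eq ?_)
        ring

end CompactSupport

/-! ### Approximate identities in `L¹` -/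

section ApproxIdentity

open Filter Topology

variable {E : Type*} [NormedAddCommGroup E] [InnerProductSpace ℝ E]

/-- The `L¹`-normalized dilation of `P` to the scale `s`. -/
noncomputable def dilate (P : E → ℝ) (s : ℝ) (x : E) : ℝ :=
  (s ^ Module.finrank ℝ E)⁻¹ * P (s⁻¹ • x)

theorem continuous_dilate {P : E → ℝ} (hP : Continuous P) (s : ℝ) : Continuous (dilate P s) :=
  continuous_const.mul (hP.comp (continuous_const_smul _))

theorem hasCompactSupport_dilate {P : E → ℝ} (hP : HasCompactSupport P) {s : ℝ} (hs : 0 < s) :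
    HasCompactSupport (dilate P s) :=
  (hP.comp_homeomorph (Homeomorph.smulOfNeZero s⁻¹ (inv_ne_zero hs.ne'))).mul_left

variable [FiniteDimensional ℝ E] [MeasurableSpace E] [BorelSpace E]
  {V : Type*} [NormedAddCommGroup V] [NormedSpace ℝ V]

/-- Translations are continuous in `L¹`. -/
theorem tendsto_lintegral_enorm_comp_sub_sub {V : Type*} [NormedAddCommGroup V] {G : E → V}
    (hG : Integrable G) :
    Tendsto (fun z => ∫⁻ x, ‖G (x - z) - G x‖ₑ) (𝓝 0) (𝓝 0) := by
  have hG1 : MemLp G 1 (volume : Measure E) := memLp_one_iff_integrable.2 hG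
  set g : C(E, C(E, E)) := (ContinuousMap.mk (fun a : E × E => a.2 - a.1) (by fun_prop)).curry
  have hgm : ∀ z, MeasurePreserving (g z) (volume : Measure E) volume := fun z =>
    measurePreserving_sub_right volume z
  have hc := (continuous_const (y := hG1.toLp G)).compMeasurePreservingLp g.continuous hgm
    ENNReal.one_ne_top
  have h0 := (hc.edist (continuous_const (y := hG1.toLp G))).tendsto 0
  simp only [Lp.toLp_compMeasurePreserving, Lp.edist_toLp_toLp] at h0
  have e : ∀ z, eLpNorm (G ∘ (g z) - G) 1 volume = ∫⁻ x, ‖G (x - z) - G x‖ₑ := fun z => by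
    rw [eLpNorm_one_eq_lintegral_enorm]; rfl
  simp only [e] at h0
  simpa using h0

theorem lintegral_enorm_comp_sub_sub_le {V : Type*} [NormedAddCommGroup V] {G : E → V} (hG : AEStronglyMeasurable G) (z : E) :
    ∫⁻ x, ‖G (x - z) - G x‖ₑ ≤ 2 * ∫⁻ x, ‖G x‖ₑ := by
  calc ∫⁻ x, ‖G (x - z) - G x‖ₑ ≤ ∫⁻ x, (‖G (x - z)‖ₑ + ‖G x‖ₑ) :=
        lintegral_mono fun x => enorm_sub_le
    _ = _ := by
        rw [lintegral_add_right' _ hG.enorm, lintegral_sub_right_eq_self (fun x => ‖G x‖ₑ), two_mul]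

theorem integral_dilate (P : E → ℝ) {s : ℝ} (hs : 0 < s) : ∫ x, dilate P s x = ∫ x, P x := by
  simp only [dilate]
  rw [integral_const_mul, Measure.integral_comp_smul, inv_pow, inv_inv, abs_of_pos (by positivity),
    smul_eq_mul, ← mul_assoc, inv_mul_cancel₀ (by positivity), one_mul]

theorem lintegral_enorm_dilate (P : E → ℝ) {s : ℝ} (hs : 0 < s) :
    ∫⁻ x, ‖dilate P s x‖ₑ = ∫⁻ x, ‖P x‖ₑ := by
  simp only [dilate, enorm_mul]
  rw [lintegral_const_mul' _ _ enorm_ne_top, lintegral_comp_inv_smul (fun x => ‖P x‖ₑ) hs,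
    Real.enorm_of_nonneg (by positivity), ← mul_assoc, ← ENNReal.ofReal_mul (by positivity),
    inv_mul_cancel₀ (by positivity), ENNReal.ofReal_one, one_mul]

theorem lintegral_enorm_dilate_comp_sub_sub (P : E → ℝ) {s : ℝ} (hs : 0 < s) (y : E) :
    ∫⁻ x, ‖dilate P s (x - y) - dilate P s x‖ₑ =
      ∫⁻ x, ‖P (x - s⁻¹ • y) - P x‖ₑ := by
  rw [← lintegral_enorm_dilate (fun x => P (x - s⁻¹ • y) - P x) hs]
  refine lintegral_congr fun x => ?_
  simp only [dilate, smul_sub, mul_sub]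

theorem integrable_kernel_smul {K : E → ℝ} (hK : Continuous K) (hKc : HasCompactSupport K)
    {G : E → V} (hG : Integrable G) (x : E) : Integrable fun y => K (x - y) • G y := by
  obtain ⟨c, hc⟩ := hKc.exists_bound_of_continuous hK
  exact hG.bdd_smul c (hK.comp (continuous_const.sub continuous_id)).aestronglyMeasurable
    (Eventually.of_forall fun y => hc _)

/-- An approximate identity at small scales. -/
theorem exists_lintegral_kernelConv_dilate_sub_le [CompleteSpace V] {P : E → ℝ} (hP : Continuous P)
    (hPc : HasCompactSupport P) {F : E → V} (hF : Integrable F) {η : ℝ≥0∞} (hη : 0 < η) :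
    ∃ δ : ℝ, 0 < δ ∧ ∫⁻ x, ‖kernelConv (dilate P δ) F x - (∫ z, P z) • F x‖ₑ ≤
      η * ∫⁻ x, ‖P x‖ₑ := by
  have ht := tendsto_lintegral_enorm_comp_sub_sub hF
  obtain ⟨r, hr, hball⟩ := Metric.eventually_nhds_iff.1 (ht.eventually (gt_mem_nhds hη))
  obtain ⟨R, hR, hsupp⟩ := hPc.isBounded.exists_pos_norm_le
  -- The support of `P` lies in the ball of radius `R`, so that of its dilate lies within `r / 2`,
  -- where translations move `F` by less than `η` in `L¹`.
  set δ := r / (2 * R) with hδ_def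
  have hδ : 0 < δ := by positivity
  refine ⟨δ, hδ, ?_⟩
  set D := dilate P δ with hD
  have hDc := continuous_dilate hP δ
  have hDs := hasCompactSupport_dilate hPc hδ
  have hDint : Integrable D := hDc.integrable_of_hasCompactSupport hDs
  have hD0 : ∀ z, D z ≠ 0 → ‖z‖ < r := by
    intro z hz
    have h1 : P (δ⁻¹ • z) ≠ 0 := fun h => hz (by simp [hD, dilate, h])
    have h2 := hsupp _ (subset_tsupport P h1)
    rw [norm_smul, norm_inv, Real.norm_of_nonneg hδ.le, inv_mul_le_iff₀ hδ] at h2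
    calc ‖z‖ ≤ δ * R := h2
      _ = r / 2 := by rw [hδ_def]; field_simp
      _ < r := by linarith
  have hpt : ∀ x, kernelConv D F x - (∫ z, P z) • F x = ∫ z, D z • (F (x - z) - F x) := by
    intro x
    have h1 : kernelConv D F x = ∫ z, D z • F (x - z) := by
      rw [kernelConv, ← integral_sub_left_eq_self (fun z => D z • F (x - z)) volume x]
      simp
    have i1 : Integrable fun z => D z • F (x - z) := by
      have := (integrable_kernel_smul hDc hDs hF x).comp_sub_left x
      simpa using this
    simp_rw [smul_sub]
    rw [integral_sub i1 (hDint.smul_const _), integral_smul_const, hD, integral_dilate P hδ, ← hD, h1]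
  have hm : AEStronglyMeasurable (fun p : E × E => D p.2 • (F (p.1 - p.2) - F p.1))
      (volume.prod volume) := by
    simp_rw [smul_sub]
    refine AEStronglyMeasurable.sub ?_ ?_
    · exact AEStronglyMeasurable.convolution_integrand (ContinuousLinearMap.lsmul ℝ ℝ)
        hDc.aestronglyMeasurable hF.1
    · exact (hDc.comp continuous_snd).aestronglyMeasurable.smul hF.1.comp_fst
  calc ∫⁻ x, ‖kernelConv D F x - (∫ z, P z) • F x‖ₑ
      ≤ ∫⁻ x, ∫⁻ z, ‖D z • (F (x - z) - F x)‖ₑ := by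
        refine lintegral_mono fun x => ?_
        rw [hpt]; exact enorm_integral_le_lintegral_enorm _
    _ = ∫⁻ z, ∫⁻ x, ‖D z • (F (x - z) - F x)‖ₑ := lintegral_lintegral_swap hm.enorm
    _ ≤ ∫⁻ z, η * ‖D z‖ₑ := by
        refine lintegral_mono fun z => ?_
        simp_rw [enorm_smul]
        rw [lintegral_const_mul' _ _ enorm_ne_top]
        by_cases hz : D z = 0
        · simp [hz]
        · rw [mul_comm]
          gcongr
          exact (hball (by simpa using hD0 z hz)).le
    _ = _ := by
        rw [lintegral_const_mul _ hDc.enorm.measurable, lintegral_enorm_dilate P hδ]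

/-- Averages over large scales of a function with vanishing integral tend to zero in `L¹`. -/
theorem exists_lintegral_kernelConv_dilate_le [CompleteSpace V] {P : E → ℝ} (hP : Continuous P)
    (hPc : HasCompactSupport P) {F : E → V} (hF : Integrable F) (hF0 : ∫ x, F x = 0)
    {η : ℝ≥0∞} (hη : 0 < η) :
    ∃ R : ℝ, 0 < R ∧ ∫⁻ x, ‖kernelConv (dilate P R) F x‖ₑ ≤ η := by
  have hPi : Integrable P := hP.integrable_of_hasCompactSupport hPc
  set modP : E → ℝ≥0∞ := fun z => ∫⁻ x, ‖P (x - z) - P x‖ₑ with hmod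
  have hmodm : Measurable modP := by
    have : Measurable fun p : E × E => ‖P (p.2 - p.1) - P p.2‖ₑ := by
      refine Continuous.measurable ?_
      fun_prop
    exact this.lintegral_prod_right'
  have hmodt : Tendsto modP (𝓝 0) (𝓝 0) := tendsto_lintegral_enorm_comp_sub_sub hPi
  -- At scale `m + 1` a shift by `y` acts on `P` as a shift by `y / (m + 1)`, so the `L¹` modulus of
  -- continuity tends to zero for each `y`, dominated by `2 ‖P‖₁ ‖F y‖`.
  have hlim : Tendsto (fun m : ℕ => ∫⁻ y, modP (((m : ℝ) + 1)⁻¹ • y) * ‖F y‖ₑ) atTop (𝓝 0) := by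
    have := tendsto_lintegral_of_dominated_convergence' (μ := (volume : Measure E))
      (F := fun (m : ℕ) y => modP (((m : ℝ) + 1)⁻¹ • y) * ‖F y‖ₑ) (f := fun _ => 0)
      (fun y => (2 * ∫⁻ x, ‖P x‖ₑ) * ‖F y‖ₑ) (fun m => ?_) (fun m => ?_) ?_ ?_
    · simpa using this
    · exact (hmodm.comp (measurable_const_smul _)).aemeasurable.mul hF.1.enorm
    · refine Eventually.of_forall fun y => ?_
      dsimp only
      gcongr
      exact lintegral_enorm_comp_sub_sub_le hPi.1 _
    · rw [lintegral_const_mul'' _ hF.1.enorm]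
      exact ENNReal.mul_ne_top (ENNReal.mul_ne_top (by simp) hPi.2.ne) hF.2.ne
    · refine Eventually.of_forall fun y => ?_
      have h1 : Tendsto (fun m : ℕ => ((m : ℝ) + 1)⁻¹ • y) atTop (𝓝 0) := by
        have := (tendsto_one_div_add_atTop_nhds_zero_nat (𝕜 := ℝ)).smul_const y
        simpa using this
      have h2 := ENNReal.Tendsto.mul_const (b := ‖F y‖ₑ) (hmodt.comp h1) (Or.inr enorm_ne_top)
      simpa using h2
  obtain ⟨m, hm⟩ := (hlim.eventually (gt_mem_nhds hη)).exists
  set R : ℝ := (m : ℝ) + 1 with hR_def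
  have hR : 0 < R := by positivity
  refine ⟨R, hR, le_trans ?_ hm.le⟩
  set D := dilate P R with hD
  have hDc := continuous_dilate hP R
  have hDs := hasCompactSupport_dilate hPc hR
  -- Subtracting `D x • F y` costs nothing because `F` has vanishing integral.
  have hpt : ∀ x, kernelConv D F x = ∫ y, (D (x - y) - D x) • F y := by
    intro x
    have i1 : Integrable fun y => D (x - y) • F y := integrable_kernel_smul hDc hDs hF x
    have i2 : Integrable fun y => D x • F y := hF.smul (D x)
    simp_rw [sub_smul]
    rw [integral_sub i1 i2, integral_smul, hF0, smul_zero, sub_zero, kernelConv]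
  have hmeas : AEStronglyMeasurable (fun p : E × E => (D (p.1 - p.2) - D p.1) • F p.2)
      (volume.prod volume) := by
    refine AEStronglyMeasurable.smul (Continuous.aestronglyMeasurable ?_) hF.1.comp_snd
    fun_prop
  calc ∫⁻ x, ‖kernelConv D F x‖ₑ
      ≤ ∫⁻ x, ∫⁻ y, ‖(D (x - y) - D x) • F y‖ₑ := by
        refine lintegral_mono fun x => ?_
        rw [hpt]; exact enorm_integral_le_lintegral_enorm _
    _ = ∫⁻ y, ∫⁻ x, ‖(D (x - y) - D x) • F y‖ₑ := lintegral_lintegral_swap hmeas.enorm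
    _ = ∫⁻ y, modP (R⁻¹ • y) * ‖F y‖ₑ := by
        refine lintegral_congr fun y => ?_
        simp_rw [enorm_smul]
        rw [lintegral_mul_const' _ _ enorm_ne_top, hD, lintegral_enorm_dilate_comp_sub_sub P hR]

/-- Gradients of integrable functions are limits in `L¹` of gradients of compactly supported
functions. -/
theorem exists_hasCompactSupport_lintegral_gradient_sub_le {u : E → ℝ} (hu : ContDiff ℝ 1 u)
    (hui : Integrable u) (hgi : Integrable (gradient u)) {η : ℝ≥0∞} (hη : 0 < η) :
    ∃ v : E → ℝ, ContDiff ℝ 1 v ∧ HasCompactSupport v ∧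
      ∫⁻ x, ‖gradient u x - gradient v x‖ₑ ≤ η := by
  let χ : ContDiffBump (0 : E) := ⟨1, 2, one_pos, one_lt_two⟩
  have hχ1 : ContDiff ℝ 1 (χ : E → ℝ) := χ.contDiff
  have hχc : HasCompactSupport (χ : E → ℝ) := χ.hasCompactSupport
  obtain ⟨c, hc⟩ := (hasCompactSupport_gradient hχc).exists_bound_of_continuous
    (continuous_gradient hχ1)
  set v : ℕ → E → ℝ := fun m x => χ (((m : ℝ) + 1)⁻¹ • x) * u x with hv
  have hv1 : ∀ m, ContDiff ℝ 1 (v m) := fun m =>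
    (hχ1.comp (contDiff_const_smul _)).mul hu
  have hvc : ∀ m, HasCompactSupport (v m) := fun m =>
    HasCompactSupport.mul_right
      (hχc.comp_homeomorph (Homeomorph.smulOfNeZero ((m : ℝ) + 1)⁻¹ (by positivity)))
  -- The error from differentiating the cutoff is `u` times a bounded factor of order `1 / (m + 1)`;
  -- integrability of `u` makes it negligible in `L¹`.
  have hgv : ∀ m x, gradient (v m) x = χ (((m : ℝ) + 1)⁻¹ • x) • gradient u x +
      u x • ((m : ℝ) + 1)⁻¹ • gradient χ (((m : ℝ) + 1)⁻¹ • x) := by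
    intro m x
    have h1 : HasGradientAt (fun x => χ (((m : ℝ) + 1)⁻¹ • x))
        (((m : ℝ) + 1)⁻¹ • gradient χ (((m : ℝ) + 1)⁻¹ • x)) x := by
      have e := gradient_comp_inv_smul hχ1 (s := (m : ℝ) + 1) (c := 1) x
      simp only [one_mul] at e
      rw [← e]
      exact ((hχ1.comp (contDiff_const_smul _)).differentiable (by simp) x).hasGradientAt
    have h2 : HasGradientAt u (gradient u x) x := (hu.differentiable (by simp) x).hasGradientAt
    refine HasGradientAt.gradient ?_
    rw [hasGradientAt_iff_hasFDerivAt] at *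
    refine (h1.mul h2).congr_fderiv ?_
    simp [map_add]
  have hlim : Tendsto (fun m : ℕ => ∫⁻ x, ‖gradient u x - gradient (v m) x‖ₑ) atTop (𝓝 0) := by
    have := tendsto_lintegral_of_dominated_convergence (μ := (volume : Measure E))
      (F := fun (m : ℕ) x => ‖gradient u x - gradient (v m) x‖ₑ) (f := fun _ => 0)
      (fun x => ENNReal.ofReal (2 * ‖gradient u x‖ + c * ‖u x‖)) (fun m => ?_) (fun m => ?_) ?_ ?_
    · simpa using this
    · exact ((continuous_gradient hu).sub (continuous_gradient (hv1 m))).enorm.measurable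
    · refine Eventually.of_forall fun x => ?_
      dsimp only
      rw [← ofReal_norm, hgv]
      refine ENNReal.ofReal_le_ofReal ?_
      have e1 : ‖χ (((m : ℝ) + 1)⁻¹ • x) • gradient u x‖ ≤ ‖gradient u x‖ := by
        rw [norm_smul, Real.norm_of_nonneg χ.nonneg]
        exact mul_le_of_le_one_left (norm_nonneg _) χ.le_one
      have e2 : ‖u x • ((m : ℝ) + 1)⁻¹ • gradient χ (((m : ℝ) + 1)⁻¹ • x)‖ ≤ c * ‖u x‖ := by
        rw [norm_smul, norm_smul, Real.norm_of_nonneg (show 0 ≤ ((m : ℝ) + 1)⁻¹ by positivity),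
          mul_comm]
        gcongr
        have : ((m : ℝ) + 1)⁻¹ ≤ 1 := inv_le_one_of_one_le₀ (by linarith [Nat.cast_nonneg (α := ℝ) m])
        calc _ ≤ 1 * ‖gradient χ (((m : ℝ) + 1)⁻¹ • x)‖ := by gcongr
          _ ≤ c := by rw [one_mul]; exact hc _
      calc _ ≤ ‖gradient u x‖ + (‖χ (((m : ℝ) + 1)⁻¹ • x) • gradient u x‖ +
            ‖u x • ((m : ℝ) + 1)⁻¹ • gradient χ (((m : ℝ) + 1)⁻¹ • x)‖) :=
            (norm_sub_le _ _).trans (by gcongr; exact norm_add_le _ _)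
        _ ≤ _ := by linarith
    · exact ((hgi.norm.const_mul 2).add (hui.norm.const_mul c)).lintegral_lt_top.ne
    · refine Eventually.of_forall fun x => ?_
      have h1 : Tendsto (fun m : ℕ => ((m : ℝ) + 1)⁻¹) atTop (𝓝 0) := by
        simpa using tendsto_one_div_add_atTop_nhds_zero_nat (𝕜 := ℝ)
      have h2 : Tendsto (fun m : ℕ => ((m : ℝ) + 1)⁻¹ • x) atTop (𝓝 0) := by
        simpa using h1.smul_const x
      have h3 : Tendsto (fun m : ℕ => χ (((m : ℝ) + 1)⁻¹ • x)) atTop (𝓝 1) := by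
        have := (χ.continuous.tendsto 0).comp h2
        rwa [χ.one_of_mem_closedBall (by simp [χ])] at this
      have h4 : Tendsto (fun m : ℕ => gradient χ (((m : ℝ) + 1)⁻¹ • x)) atTop
          (𝓝 (gradient χ 0)) := ((continuous_gradient hχ1).tendsto 0).comp h2
      have h5 : Tendsto (fun m => gradient u x - gradient (v m) x) atTop (𝓝 0) := by
        simp_rw [hgv]
        have := ((h3.smul_const (gradient u x)).add
          ((h1.smul h4).const_smul (u x))).const_sub (gradient u x)
        simpa using this
      simpa using h5.enorm
  obtain ⟨m, hm⟩ := (hlim.eventually (gt_mem_nhds hη)).exists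
  exact ⟨v m, hv1 m, hvc m, hm.le⟩

end ApproxIdentity

/-! ### Curl-free fields are limits of gradients -/

section CurlFree

open Filter Topology

/-- The radial profile of the regularized field `x ↦ |x|^{-n} x`, as a function of `|x|²`. -/
noncomputable def newtonProfile (n s : ℝ) : ℝ := s ^ (-n / 2) * Real.smoothTransition (s - 1)

/-- The divergence of the regularized field `x ↦ |x|^{-n} x`, as a function of `|x|²`. -/
noncomputable def divProfile (n s : ℝ) : ℝ :=
  s ^ (1 - n / 2) * (2 * deriv Real.smoothTransition (s - 1))

theorem deriv_smoothTransition_eq_zero_of_neg {s : ℝ} (hs : s < 0) :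
    deriv Real.smoothTransition s = 0 := by
  have : Real.smoothTransition =ᶠ[𝓝 s] fun _ => 0 := by
    filter_upwards [Iio_mem_nhds hs] with t ht
    exact Real.smoothTransition.zero_of_nonpos (le_of_lt ht)
  rw [this.deriv_eq, deriv_const]

theorem deriv_smoothTransition_eq_zero_of_one_lt {s : ℝ} (hs : 1 < s) :
    deriv Real.smoothTransition s = 0 := by
  have : Real.smoothTransition =ᶠ[𝓝 s] fun _ => 1 := by
    filter_upwards [Ioi_mem_nhds hs] with t ht
    exact Real.smoothTransition.one_of_one_le (le_of_lt ht)
  rw [this.deriv_eq, deriv_const]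

theorem contDiff_newtonProfile (n : ℝ) : ContDiff ℝ ∞ (newtonProfile n) := by
  refine contDiff_rpow_mul_of_eq_zero ?_ (fun s hs => ?_) _
  · exact Real.smoothTransition.contDiff.comp (contDiff_id.sub contDiff_const)
  · exact Real.smoothTransition.zero_of_nonpos (by linarith)

theorem contDiff_divProfile (n : ℝ) : ContDiff ℝ ∞ (divProfile n) := by
  refine contDiff_rpow_mul_of_eq_zero ?_ (fun s hs => ?_) _
  · have h : ContDiff ℝ ∞ (deriv Real.smoothTransition) :=
      (contDiff_infty_iff_deriv.1 Real.smoothTransition.contDiff).2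
    exact contDiff_const.mul (h.comp (contDiff_id.sub contDiff_const))
  · rw [deriv_smoothTransition_eq_zero_of_neg (by linarith), mul_zero]

theorem divProfile_nonneg (n : ℝ) {s : ℝ} (hs : 0 ≤ s) : 0 ≤ divProfile n s :=
  mul_nonneg (Real.rpow_nonneg hs _)
    (mul_nonneg zero_le_two (Real.smoothTransition.monotone.deriv_nonneg))

theorem divProfile_eq_zero (n : ℝ) {s : ℝ} (hs : 2 < s) : divProfile n s = 0 := by
  rw [divProfile, deriv_smoothTransition_eq_zero_of_one_lt (by linarith), mul_zero, mul_zero]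

/-- Otherwise the transition function would have zero derivative everywhere, yet it goes from `0` to
`1`. This makes the integral of the approximate identity positive. -/
theorem exists_divProfile_ne_zero (n : ℝ) : ∃ s, 0 < s ∧ divProfile n s ≠ 0 := by
  by_contra! h
  have hd : ∀ t, deriv Real.smoothTransition t = 0 := by
    intro t
    rcases lt_or_ge t 0 with ht | ht
    · exact deriv_smoothTransition_eq_zero_of_neg ht
    · have h1 := h (t + 1) (by linarith)
      have h2 : (t + 1 : ℝ) ^ (1 - n / 2) ≠ 0 := (Real.rpow_pos_of_pos (by linarith) _).ne'
      rw [divProfile, mul_eq_zero, or_iff_right h2] at h1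
      simpa using h1
  have hdiff : Differentiable ℝ Real.smoothTransition :=
    (Real.smoothTransition.contDiff (n := 1)).differentiable (by simp)
  have := is_const_of_deriv_eq_zero hdiff hd 0 1
  simp at this

/-- The field `|x|^{-n} x` is divergence-free off the origin: `2 s ∂_s + n` annihilates `s^{-n/2}`.
Only the derivative of the cutoff survives, which is why the divergence has compact support although
the field does not. -/
theorem newtonProfile_deriv (n : ℝ) (s : ℝ) :
    2 * s * deriv (newtonProfile n) s + n * newtonProfile n s = divProfile n s := by
  rcases lt_or_ge s 1 with hs | hs
  · have h0 : newtonProfile n =ᶠ[𝓝 s] fun _ => 0 := by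
      filter_upwards [Iio_mem_nhds hs] with t ht
      have ht' : t < 1 := ht
      rw [newtonProfile, Real.smoothTransition.zero_of_nonpos (by linarith), mul_zero]
    rw [h0.deriv_eq, h0.eq_of_nhds, divProfile,
      deriv_smoothTransition_eq_zero_of_neg (by linarith)]
    simp
  · have hs0 : 0 < s := by linarith
    have h1 : HasDerivAt (fun s : ℝ => s ^ (-n / 2)) ((-n / 2) * s ^ (-n / 2 - 1)) s :=
      Real.hasDerivAt_rpow_const (Or.inl hs0.ne')
    have hdiff : Differentiable ℝ Real.smoothTransition :=
      (Real.smoothTransition.contDiff (n := 1)).differentiable (by simp)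
    have h2 : HasDerivAt (fun s : ℝ => Real.smoothTransition (s - 1))
        (deriv Real.smoothTransition (s - 1)) s :=
      (hdiff (s - 1)).hasDerivAt.comp_sub_const s 1
    have h3 : deriv (newtonProfile n) s = _ := (h1.mul h2).deriv
    rw [h3, newtonProfile, divProfile, Real.rpow_sub_one hs0.ne',
      show 1 - n / 2 = -n / 2 + 1 by ring, Real.rpow_add_one hs0.ne']
    field_simp
    ring

variable {d : ℕ}

theorem gradient_apply (u : EuclideanSpace ℝ (Fin d) → ℝ) (x : EuclideanSpace ℝ (Fin d))
    (k : Fin d) : gradient u x k = fderiv ℝ u x (EuclideanSpace.single k 1) := by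
  rw [← inner_gradient_left, EuclideanSpace.inner_single_right]; simp

theorem sum_fderiv_radial {g : ℝ → ℝ} (hg : Differentiable ℝ g) (x : EuclideanSpace ℝ (Fin d)) :
    ∑ i, fderiv ℝ (fun x : EuclideanSpace ℝ (Fin d) => g (‖x‖ ^ 2) * x i) x
      (EuclideanSpace.single i 1) = 2 * ‖x‖ ^ 2 * deriv g (‖x‖ ^ 2) + d * g (‖x‖ ^ 2) := by
  have h : ∀ i, fderiv ℝ (fun x : EuclideanSpace ℝ (Fin d) => g (‖x‖ ^ 2) * x i) x
      (EuclideanSpace.single i 1) = 2 * x i ^ 2 * deriv g (‖x‖ ^ 2) + g (‖x‖ ^ 2) := by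
    intro i
    have h1 : HasFDerivAt (fun x : EuclideanSpace ℝ (Fin d) => ‖x‖ ^ 2) _ x :=
      (hasStrictFDerivAt_norm_sq x).hasFDerivAt
    have h2 := (hg (‖x‖ ^ 2)).hasDerivAt.comp_hasFDerivAt x h1
    have h3 : HasFDerivAt (fun x : EuclideanSpace ℝ (Fin d) => x i)
        (EuclideanSpace.proj i : EuclideanSpace ℝ (Fin d) →L[ℝ] ℝ) x :=
      (EuclideanSpace.proj i : EuclideanSpace ℝ (Fin d) →L[ℝ] ℝ).hasFDerivAt
    have h4 := (h2.mul h3).fderiv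
    simp only [Function.comp_def] at h4
    erw [h4]
    simp [EuclideanSpace.inner_single_right]
    ring
  simp_rw [h]
  rw [Finset.sum_add_distrib, ← Finset.sum_mul, ← Finset.mul_sum, EuclideanSpace.norm_sq_eq]
  simp

/-- Convolving a curl-free field with a test field gives a potential of the convolution with the
divergence of the test field. -/
theorem CurlFree.potential {F : EuclideanSpace ℝ (Fin d) → EuclideanSpace ℝ (Fin d)}
    (hF : Integrable F) (hcurl : CurlFree F) {Q : Fin d → EuclideanSpace ℝ (Fin d) → ℝ}
    (hQ : ∀ i, ContDiff ℝ ∞ (Q i)) (hQc : ∀ i, HasCompactSupport (Q i)) :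
    ∃ u : EuclideanSpace ℝ (Fin d) → ℝ, ContDiff ℝ 1 u ∧ Integrable u ∧
      ∀ x, gradient u x =
        kernelConv (fun z => ∑ i, fderiv ℝ (Q i) z (EuclideanSpace.single i 1)) F x := by
  have hFi : ∀ i, Integrable fun x => F x i := fun i =>
    (EuclideanSpace.proj i : EuclideanSpace ℝ (Fin d) →L[ℝ] ℝ).integrable_comp hF
  have hQ1 : ∀ i, ContDiff ℝ 1 (Q i) := fun i => (hQ i).of_le (by exact_mod_cast le_top)
  set U : Fin d → EuclideanSpace ℝ (Fin d) → ℝ := fun i =>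
    convolution (fun x => F x i) (Q i) (ContinuousLinearMap.mul ℝ ℝ) volume with hU
  have hfd : ∀ i x, HasFDerivAt (U i) _ x := fun i x =>
    (hQc i).hasFDerivAt_convolution_right (ContinuousLinearMap.mul ℝ ℝ)
      (hFi i).locallyIntegrable (hQ1 i) x
  have hfd' : ∀ i x k, fderiv ℝ (U i) x (EuclideanSpace.single k 1) =
      ∫ y, F y i * fderiv ℝ (Q i) (x - y) (EuclideanSpace.single k 1) := by
    intro i x k
    rw [(hfd i x).fderiv, convolution_precompR_apply _ (hFi i).locallyIntegrable
      ((hQc i).fderiv (𝕜 := ℝ)) ((hQ1 i).continuous_fderiv (by simp))]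
    rfl
  -- Curl-freeness tested against `y ↦ Q i (x - y)`: `∂_k (F_i * Q_i) = F_k * ∂_i Q_i`. Summing over
  -- `i` makes the divergence of `Q` appear.
  have hswap : ∀ i x k, ∫ y, F y i * fderiv ℝ (Q i) (x - y) (EuclideanSpace.single k 1) =
      ∫ y, F y k * fderiv ℝ (Q i) (x - y) (EuclideanSpace.single i 1) := by
    intro i x k
    have hφ : ContDiff ℝ ∞ fun y => Q i (x - y) := (hQ i).comp (contDiff_const.sub contDiff_id)
    have hφc : HasCompactSupport fun y => Q i (x - y) :=
      (hQc i).comp_homeomorph (Homeomorph.subLeft x)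
    have hd : ∀ y w, fderiv ℝ (fun y => Q i (x - y)) y w = - fderiv ℝ (Q i) (x - y) w := by
      intro y w
      have := ((hQ1 i).differentiable (by simp) (x - y)).hasFDerivAt.comp y
        ((hasFDerivAt_id y).const_sub x)
      have h := this.fderiv
      simp only [Function.comp_def] at h
      rw [h]; simp
    have h := hcurl i k _ hφ hφc
    simp_rw [hd, mul_neg, integral_neg] at h
    exact neg_injective h
  refine ⟨fun x => ∑ i, U i x, ?_, ?_, fun x => ?_⟩
  · exact ContDiff.sum fun i _ => (hQc i).contDiff_convolution_right (n := 1) _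
      (hFi i).locallyIntegrable (hQ1 i)
  · exact integrable_finsetSum _ fun i _ => (hFi i).integrable_convolution _
      ((hQ i).continuous.integrable_of_hasCompactSupport (hQc i))
  · have hcont : ∀ i, Continuous fun z => fderiv ℝ (Q i) z (EuclideanSpace.single i 1) := fun i =>
      ((hQ1 i).continuous_fderiv (by simp)).clm_apply continuous_const
    have hcs : ∀ i, HasCompactSupport fun z => fderiv ℝ (Q i) z (EuclideanSpace.single i 1) :=
      fun i => (hQc i).fderiv_apply ℝ _
    have hK : ∀ i, Integrable fun y =>
        (fderiv ℝ (Q i) (x - y) (EuclideanSpace.single i 1)) • F y := fun i =>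
      integrable_kernel_smul (hcont i) (hcs i) hF x
    have hsum : kernelConv (fun z => ∑ i, fderiv ℝ (Q i) z (EuclideanSpace.single i 1)) F x =
        ∑ i, ∫ y, (fderiv ℝ (Q i) (x - y) (EuclideanSpace.single i 1)) • F y := by
      rw [kernelConv, ← integral_finsetSum _ fun i _ => hK i]
      simp_rw [Finset.sum_smul]
    ext k
    rw [gradient_apply, hsum, (HasFDerivAt.fun_sum fun i _ => (hfd i x)).fderiv]
    have hk : (∑ i, ∫ y, (fderiv ℝ (Q i) (x - y) (EuclideanSpace.single i 1)) • F y).ofLp k =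
        ∑ i, (∫ y, (fderiv ℝ (Q i) (x - y) (EuclideanSpace.single i 1)) • F y).ofLp k := by
      simp
    rw [hk, sum_apply]
    refine Finset.sum_congr rfl fun i _ => ?_
    rw [← (hfd i x).fderiv, hfd', hswap, eval_integral_piLp]
    · refine integral_congr_ae (Eventually.of_forall fun y => ?_)
      simp [mul_comm]
    · exact fun j => (EuclideanSpace.proj j : EuclideanSpace ℝ (Fin d) →L[ℝ] ℝ).integrable_comp (hK i)

/-- Integrable curl-free fields have vanishing integral. -/
theorem CurlFree.integral_eq_zero (hd : 2 ≤ d)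
    {F : EuclideanSpace ℝ (Fin d) → EuclideanSpace ℝ (Fin d)}
    (hF : Integrable F) (hcurl : CurlFree F) : ∫ x, F x = 0 := by
  have hFi : ∀ i, Integrable fun x => F x i := fun i =>
    (EuclideanSpace.proj i : EuclideanSpace ℝ (Fin d) →L[ℝ] ℝ).integrable_comp hF
  ext i
  rw [eval_integral_piLp hFi]
  obtain ⟨j, hj⟩ : ∃ j : Fin d, j ≠ i := by
    have : Nontrivial (Fin d) := Fin.nontrivial_iff_two_le.2 hd
    exact exists_ne i
  let χ : ContDiffBump (0 : EuclideanSpace ℝ (Fin d)) := ⟨1, 2, one_pos, one_lt_two⟩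
  -- The rescaled functions `(m + 1) ψ(x / (m + 1))` agree with the coordinate `x_j` on growing
  -- balls and have uniformly bounded gradients. In the limit the curl condition with `j ≠ i` reads
  -- `∫ F_i = 0`.
  set ψ : EuclideanSpace ℝ (Fin d) → ℝ := fun x => x j * χ x with hψ_def
  have hψ : ContDiff ℝ ∞ ψ :=
    (EuclideanSpace.proj j : EuclideanSpace ℝ (Fin d) →L[ℝ] ℝ).contDiff.mul χ.contDiff
  have hψ1 : ContDiff ℝ 1 ψ := hψ.of_le (by exact_mod_cast le_top)
  have hψc : HasCompactSupport ψ := χ.hasCompactSupport.mul_left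
  have hψ0 : ∀ w, fderiv ℝ ψ 0 w = w j := by
    intro w
    have : ψ =ᶠ[𝓝 0] fun x => x j := by
      filter_upwards [χ.eventuallyEq_one] with x hx
      simp [hψ_def, hx]
    rw [this.fderiv_eq]
    exact congrArg (· w) (EuclideanSpace.proj j : EuclideanSpace ℝ (Fin d) →L[ℝ] ℝ).fderiv
  obtain ⟨c, hc⟩ := (hψc.fderiv (𝕜 := ℝ)).exists_bound_of_continuous
    (hψ1.continuous_fderiv (by simp))
  have hlim : ∀ k l : Fin d, Tendsto (fun m : ℕ => ∫ x, F x k *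
      fderiv ℝ ψ (((m : ℝ) + 1)⁻¹ • x) (EuclideanSpace.single l 1)) atTop
      (𝓝 (∫ x, F x k * (EuclideanSpace.single l (1 : ℝ)) j)) := by
    intro k l
    refine tendsto_integral_of_dominated_convergence (fun x => ‖F x k‖ * c) (fun m => ?_)
      ((hFi k).norm.mul_const c) (fun m => ?_) ?_
    · refine (hFi k).1.mul (Continuous.aestronglyMeasurable ?_)
      exact ((hψ1.continuous_fderiv (by simp)).comp (continuous_const_smul _)).clm_apply
        continuous_const
    · refine Eventually.of_forall fun x => ?_
      rw [norm_mul]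
      gcongr
      refine (ContinuousLinearMap.le_opNorm _ _).trans ?_
      simpa using hc _
    · refine Eventually.of_forall fun x => ?_
      have h1 : Tendsto (fun m : ℕ => ((m : ℝ) + 1)⁻¹ • x) atTop (𝓝 0) := by
        have := (tendsto_one_div_add_atTop_nhds_zero_nat (𝕜 := ℝ)).smul_const x
        simpa using this
      have h2 : Continuous fun z => fderiv ℝ ψ z (EuclideanSpace.single l 1) :=
        (hψ1.continuous_fderiv (by simp)).clm_apply continuous_const
      have h3 := ((h2.tendsto 0).comp h1).const_mul (F x k)
      rw [hψ0] at h3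
      exact h3
  have heq : ∀ m : ℕ, ∫ x, F x i * fderiv ℝ ψ (((m : ℝ) + 1)⁻¹ • x) (EuclideanSpace.single j 1) =
      ∫ x, F x j * fderiv ℝ ψ (((m : ℝ) + 1)⁻¹ • x) (EuclideanSpace.single i 1) := by
    intro m
    have hm : (m : ℝ) + 1 ≠ 0 := by positivity
    set φ : EuclideanSpace ℝ (Fin d) → ℝ := fun x => ((m : ℝ) + 1) * ψ (((m : ℝ) + 1)⁻¹ • x)
    have hφ : ContDiff ℝ ∞ φ := contDiff_const.mul (hψ.comp (contDiff_const_smul _))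
    have hφc : HasCompactSupport φ := HasCompactSupport.mul_left
      (hψc.comp_homeomorph (Homeomorph.smulOfNeZero ((m : ℝ) + 1)⁻¹ (inv_ne_zero hm)))
    have hd : ∀ x w, fderiv ℝ φ x w = fderiv ℝ ψ (((m : ℝ) + 1)⁻¹ • x) w := by
      intro x w
      rw [← inner_gradient_left, ← inner_gradient_left, gradient_comp_inv_smul hψ1,
        mul_inv_cancel₀ hm, one_smul]
    have h := hcurl i j φ hφ hφc
    simpa only [hd] using h
  have := tendsto_nhds_unique ((hlim i j).congr heq) (hlim j i)
  simpa [hj] using this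

/-- Gradients of compactly supported functions are dense in the integrable curl-free fields. -/
theorem CurlFree.exists_lintegral_sub_gradient_le (hd : 2 ≤ d)
    {F : EuclideanSpace ℝ (Fin d) → EuclideanSpace ℝ (Fin d)}
    (hF : Integrable F) (hcurl : CurlFree F) {η : ℝ≥0∞} (hη : 0 < η) :
    ∃ u : EuclideanSpace ℝ (Fin d) → ℝ, ContDiff ℝ 1 u ∧ HasCompactSupport u ∧
      ∫⁻ x, ‖F x - gradient u x‖ₑ ≤ η := by
  set P : EuclideanSpace ℝ (Fin d) → ℝ := fun x => divProfile d (‖x‖ ^ 2) with hP_def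
  have hPs : ContDiff ℝ ∞ P := (contDiff_divProfile d).comp (contDiff_norm_sq ℝ)
  have hP := hPs.continuous
  have hPc : HasCompactSupport P := by
    refine HasCompactSupport.intro (isCompact_closedBall 0 2) fun x hx => ?_
    have : 2 < ‖x‖ := by simpa using hx
    exact divProfile_eq_zero _ (by nlinarith)
  have hPi : Integrable P := hP.integrable_of_hasCompactSupport hPc
  set κ : ℝ := ∫ x, P x with hκ_def
  have hκ : 0 < κ := by
    obtain ⟨s, hs, hs'⟩ := exists_divProfile_ne_zero d
    have : Nontrivial (EuclideanSpace ℝ (Fin d)) := by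
      have : Nonempty (Fin d) := ⟨⟨0, by lia⟩⟩
      infer_instance
    obtain ⟨x, hx⟩ := exists_norm_eq (EuclideanSpace ℝ (Fin d)) (Real.sqrt_nonneg s)
    refine hP.integral_pos_of_hasCompactSupport_nonneg_nonzero hPc
      (fun x => divProfile_nonneg _ (by positivity)) (x := x) ?_
    rw [hP_def]
    simp only [hx, Real.sq_sqrt hs.le]
    exact hs'
  -- The error `η` is shared by the narrow average, the wide average and the final cutoff; the first
  -- two are multiplied by `κ⁻¹`.
  obtain ⟨η', hη', hη'le⟩ : ∃ η' : ℝ≥0∞, 0 < η' ∧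
      ENNReal.ofReal κ⁻¹ * (η' * (∫⁻ x, ‖P x‖ₑ) + η') + η' ≤ η := by
    set c : ℝ≥0∞ := ENNReal.ofReal κ⁻¹ * ((∫⁻ x, ‖P x‖ₑ) + 1) + 1 with hc
    have hctop : c ≠ ⊤ := ENNReal.add_ne_top.2 ⟨ENNReal.mul_ne_top ENNReal.ofReal_ne_top
      (ENNReal.add_ne_top.2 ⟨hPi.2.ne, ENNReal.one_ne_top⟩), ENNReal.one_ne_top⟩
    have hc0 : c ≠ 0 := by simp [hc]
    refine ⟨η / c, ENNReal.div_pos hη.ne' hctop, ?_⟩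
    calc _ = η / c * c := by rw [hc]; ring
      _ ≤ η := (ENNReal.div_mul_cancel hc0 hctop).le
  obtain ⟨δ, hδ, h1⟩ := exists_lintegral_kernelConv_dilate_sub_le hP hPc hF hη'
  obtain ⟨R, hR, h2⟩ := exists_lintegral_kernelConv_dilate_le hP hPc hF
    (hcurl.integral_eq_zero hd hF) hη'
  set gs : ℝ → ℝ → ℝ := fun r s => (r ^ d)⁻¹ * newtonProfile d (s / r ^ 2) with hgs_def
  have hgs : ∀ r, ContDiff ℝ ∞ (gs r) := fun r =>
    contDiff_const.mul ((contDiff_newtonProfile d).comp (contDiff_id.div_const _))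
  -- Far out, the profile does not depend on the dilation parameter, so the difference of two
  -- dilates has compact support and yields a legitimate test field.
  have hgs_large : ∀ r s : ℝ, 0 < r → 2 * r ^ 2 ≤ s → gs r s = s ^ (-(d : ℝ) / 2) := by
    intro r s hr hs
    have hs0 : 0 ≤ s := le_trans (by positivity) hs
    have e : 2 ≤ s / r ^ 2 := (le_div_iff₀ (by positivity)).2 hs
    simp only [hgs_def, newtonProfile]
    rw [Real.smoothTransition.one_of_one_le (by linarith), mul_one,
      Real.div_rpow hs0 (by positivity), ← Real.rpow_natCast r 2, ← Real.rpow_mul hr.le,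
      show ((2 : ℕ) : ℝ) * (-(d : ℝ) / 2) = -(d : ℝ) by push_cast; ring, Real.rpow_neg hr.le,
      Real.rpow_natCast]
    field_simp
  have hgs_deriv : ∀ r x, 0 < r → 2 * ‖x‖ ^ 2 * deriv (gs r) (‖x‖ ^ 2) + d * gs r (‖x‖ ^ 2) =
      dilate P r x := by
    intro r x hr
    have hdiff : Differentiable ℝ (newtonProfile (d : ℝ)) :=
      (contDiff_newtonProfile d).differentiable (by simp)
    have hder : deriv (gs r) (‖x‖ ^ 2) =
        (r ^ d)⁻¹ * (deriv (newtonProfile d) (‖x‖ ^ 2 / r ^ 2) * (1 / r ^ 2)) := by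
      have := ((hdiff (‖x‖ ^ 2 / r ^ 2)).hasDerivAt.comp (‖x‖ ^ 2)
        ((hasDerivAt_id (‖x‖ ^ 2)).div_const (r ^ 2))).const_mul ((r ^ d)⁻¹)
      exact this.deriv
    have hnorm : ‖r⁻¹ • x‖ ^ 2 = ‖x‖ ^ 2 / r ^ 2 := by
      rw [norm_smul, norm_inv, Real.norm_of_nonneg hr.le]; field_simp
    simp only [dilate, hP_def, finrank_euclideanSpace, Fintype.card_fin]
    rw [hnorm, ← newtonProfile_deriv, hder]
    simp only [hgs_def]
    ring
  set g : ℝ → ℝ := fun s => κ⁻¹ * (gs δ s - gs R s) with hg_def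
  have hg : ContDiff ℝ ∞ g := contDiff_const.mul ((hgs δ).sub (hgs R))
  have hgs_diff : ∀ r, Differentiable ℝ (gs r) := fun r => (hgs r).differentiable (by simp)
  set Q : Fin d → EuclideanSpace ℝ (Fin d) → ℝ := fun i x => g (‖x‖ ^ 2) * x i with hQ_def
  have hQ : ∀ i, ContDiff ℝ ∞ (Q i) := fun i => (hg.comp (contDiff_norm_sq ℝ)).mul
    (EuclideanSpace.proj i : EuclideanSpace ℝ (Fin d) →L[ℝ] ℝ).contDiff
  have hQc : ∀ i, HasCompactSupport (Q i) := by
    intro i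
    refine HasCompactSupport.intro (isCompact_closedBall 0 (2 * (δ + R))) fun x hx => ?_
    have hx' : 2 * (δ + R) < ‖x‖ := by simpa using hx
    have e1 : 2 * δ ^ 2 ≤ ‖x‖ ^ 2 := by nlinarith
    have e2 : 2 * R ^ 2 ≤ ‖x‖ ^ 2 := by nlinarith
    simp only [hQ_def, hg_def]
    rw [hgs_large δ _ hδ e1, hgs_large R _ hR e2, sub_self, mul_zero, zero_mul]
  have hdiv : (fun z => ∑ i, fderiv ℝ (Q i) z (EuclideanSpace.single i 1)) =
      fun z => κ⁻¹ * (dilate P δ z - dilate P R z) := by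
    funext z
    simp only [hQ_def]
    rw [sum_fderiv_radial (hg.differentiable (by simp)), ← hgs_deriv δ z hδ, ← hgs_deriv R z hR]
    have : deriv g (‖z‖ ^ 2) = κ⁻¹ * (deriv (gs δ) (‖z‖ ^ 2) - deriv (gs R) (‖z‖ ^ 2)) :=
      (((hgs_diff δ _).hasDerivAt.sub (hgs_diff R _).hasDerivAt).const_mul κ⁻¹).deriv
    rw [this, hg_def]
    ring
  obtain ⟨u, hu1, hui, hgu⟩ := hcurl.potential hF hQ hQc
  rw [hdiv] at hgu
  have hgu' : ∀ x, gradient u x =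
      κ⁻¹ • (kernelConv (dilate P δ) F x - kernelConv (dilate P R) F x) := by
    intro x
    have i1 := integrable_kernel_smul (continuous_dilate hP δ) (hasCompactSupport_dilate hPc hδ) hF x
    have i2 := integrable_kernel_smul (continuous_dilate hP R) (hasCompactSupport_dilate hPc hR) hF x
    rw [hgu]
    simp only [kernelConv]
    rw [← integral_sub i1 i2, ← integral_smul]
    refine integral_congr_ae (Eventually.of_forall fun y => ?_)
    simp only [mul_smul, sub_smul]
  have hdist : ∫⁻ x, ‖F x - gradient u x‖ₑ ≤
      ENNReal.ofReal κ⁻¹ * (η' * (∫⁻ x, ‖P x‖ₑ) + η') := by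
    have hpt : ∀ x, ‖F x - gradient u x‖ₑ ≤ ENNReal.ofReal κ⁻¹ *
        (‖kernelConv (dilate P δ) F x - κ • F x‖ₑ + ‖kernelConv (dilate P R) F x‖ₑ) := by
      intro x
      have : F x - gradient u x = κ⁻¹ • (-(kernelConv (dilate P δ) F x - κ • F x) +
          kernelConv (dilate P R) F x) := by
        have e : κ⁻¹ • κ • F x = F x := by rw [smul_smul, inv_mul_cancel₀ hκ.ne', one_smul]
        simp only [hgu', smul_add, smul_neg, smul_sub, e]
        abel
      rw [this, enorm_smul, Real.enorm_of_nonneg (by positivity)]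
      gcongr
      refine (enorm_add_le _ _).trans ?_
      rw [enorm_neg]
    calc _ ≤ ∫⁻ x, ENNReal.ofReal κ⁻¹ *
        (‖kernelConv (dilate P δ) F x - κ • F x‖ₑ + ‖kernelConv (dilate P R) F x‖ₑ) :=
          lintegral_mono hpt
      _ = ENNReal.ofReal κ⁻¹ * ((∫⁻ x, ‖kernelConv (dilate P δ) F x - κ • F x‖ₑ) +
          ∫⁻ x, ‖kernelConv (dilate P R) F x‖ₑ) := by
          rw [lintegral_const_mul' _ _ ENNReal.ofReal_ne_top, lintegral_add_right']
          exact (aestronglyMeasurable_kernelConv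
            (continuous_dilate hP R).aestronglyMeasurable hF.1).enorm
      _ ≤ _ := by gcongr
  have hgi : Integrable (gradient u) := by
    have hD : ∀ r, 0 < r → Integrable (dilate P r) := fun r hr =>
      (continuous_dilate hP r).integrable_of_hasCompactSupport (hasCompactSupport_dilate hPc hr)
    have hK : Integrable fun z => κ⁻¹ * (dilate P δ z - dilate P R z) :=
      ((hD δ hδ).sub (hD R hR)).const_mul _
    refine ⟨(continuous_gradient hu1).aestronglyMeasurable, ?_⟩
    rw [show gradient u = _ from funext hgu]
    exact (lintegral_kernelConv_le hK.1 hF.1).trans_lt (ENNReal.mul_lt_top hK.2 hF.2)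
  obtain ⟨v, hv1, hvc, hv⟩ := exists_hasCompactSupport_lintegral_gradient_sub_le hu1 hui hgi hη'
  refine ⟨v, hv1, hvc, ?_⟩
  calc ∫⁻ x, ‖F x - gradient v x‖ₑ
      ≤ ∫⁻ x, (‖F x - gradient u x‖ₑ + ‖gradient u x - gradient v x‖ₑ) := by
        refine lintegral_mono fun x => ?_
        rw [← sub_add_sub_cancel (F x) (gradient u x) (gradient v x)]
        exact enorm_add_le _ _
    _ = (∫⁻ x, ‖F x - gradient u x‖ₑ) + ∫⁻ x, ‖gradient u x - gradient v x‖ₑ :=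
        lintegral_add_right _
          ((continuous_gradient hu1).sub (continuous_gradient hv1)).enorm.measurable
    _ ≤ _ := (add_le_add hdist hv).trans hη'le

end CurlFree

/-! ### The endpoint estimate -/

section Main

open Filter Topology

variable {d : ℕ}

theorem ae_integrable_rieszIntegrand {α : ℝ} (hα₀ : 0 < α) (hαd : α < d)
    {F : EuclideanSpace ℝ (Fin d) → EuclideanSpace ℝ (Fin d)} (hF : Integrable F) :
    ∀ᵐ x : EuclideanSpace ℝ (Fin d), ∀ i : Fin d,
      Integrable (rieszIntegrand α (fun y => F y i) x) volume := by
  have hfin : (Module.finrank ℝ (EuclideanSpace ℝ (Fin d)) : ℝ) = d := by simp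
  filter_upwards [ae_integrable_rpow_smul (β := d - α) (by linarith) (by rw [hfin]; linarith) hF]
    with x hx i
  refine ((EuclideanSpace.proj i : EuclideanSpace ℝ (Fin d) →L[ℝ] ℝ).integrable_comp hx).congr
    (Eventually.of_forall fun y => ?_)
  simp only [rieszIntegrand]
  rw [div_eq_mul_inv, ← Real.rpow_neg (norm_nonneg _)]
  simp [mul_comm]

theorem rieszPotentialVec_eq {α : ℝ} {F : EuclideanSpace ℝ (Fin d) → EuclideanSpace ℝ (Fin d)}
    {x : EuclideanSpace ℝ (Fin d)}
    (hx : ∀ i : Fin d, Integrable (rieszIntegrand α (fun y => F y i) x) volume) :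
    rieszPotentialVec α F x =
      (1 / rieszConst d α) • kernelConv (fun x => ‖x‖ ^ (-((d : ℝ) - α))) F x := by
  have h : ∀ i y, (‖x - y‖ ^ (-((d : ℝ) - α)) • F y) i = rieszIntegrand α (fun y => F y i) x y := by
    intro i y
    rw [rieszIntegrand, div_eq_mul_inv, ← Real.rpow_neg (norm_nonneg _)]
    simp [mul_comm]
  ext i
  simp only [rieszPotentialVec, rieszPotential, PiLp.smul_apply, smul_eq_mul, kernelConv]
  rw [eval_integral_piLp]
  · simp_rw [h]
  · intro i
    simp_rw [h]
    exact hx i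

/-- The Riesz potential of an integrable curl-free field. -/
theorem exists_atomicBound_of_curlFree {α : ℝ} (hd : 2 ≤ d) (hα₀ : 0 < α) (hαd : α < d) :
    ∃ C : ℝ, 0 < C ∧ ∀ F : EuclideanSpace ℝ (Fin d) → EuclideanSpace ℝ (Fin d),
      Integrable F → CurlFree F →
      AtomicBound (α / d) (kernelConv (fun x => ‖x‖ ^ (-((d : ℝ) - α))) F)
        (ENNReal.ofReal C * ∫⁻ x, ‖F x‖ₑ) := by
  have hfin : Module.finrank ℝ (EuclideanSpace ℝ (Fin d)) = d := by simp
  obtain ⟨C, hC, hgrad⟩ := exists_atomicBound_gradient (E := EuclideanSpace ℝ (Fin d))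
    (α := α) (by rw [hfin]; exact hd) hα₀ (by rw [hfin]; exact hαd)
  rw [hfin] at hgrad
  -- The telescoped gradients have masses at most `3 N₀ 2^{-m}`, which sum to `6 N₀`.
  refine ⟨C * 6, by positivity, fun F hF hcurl => ?_⟩
  set K : EuclideanSpace ℝ (Fin d) → ℝ := fun x => ‖x‖ ^ (-((d : ℝ) - α)) with hK
  have hint : ∀ {G : EuclideanSpace ℝ (Fin d) → EuclideanSpace ℝ (Fin d)}, Integrable G →
      ∀ᵐ x, Integrable fun y => K (x - y) • G y := fun hG =>
    ae_integrable_rpow_smul (β := d - α) (by linarith) (by rw [hfin]; linarith) hG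
  set N₀ : ℝ≥0∞ := ∫⁻ x, ‖F x‖ₑ with hN₀
  have hN₀top : N₀ ≠ ⊤ := hF.2.ne
  -- The tolerances `N₀ 2^{-m}` used below must be positive.
  rcases eq_or_ne N₀ 0 with h0 | h0
  · refine AtomicBound.of_ae_eq_zero (Eventually.of_forall fun x => ?_)
    rw [hN₀, lintegral_eq_zero_iff' hF.1.enorm] at h0
    rw [kernelConv, Pi.zero_apply]
    refine integral_eq_zero_of_ae ?_
    filter_upwards [h0] with y hy
    have : F y = 0 := by simpa using hy
    simp [this]
  have hε : ∀ m : ℕ, 0 < N₀ * (2⁻¹ : ℝ≥0∞) ^ m := fun m =>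
    ENNReal.mul_pos h0 (pow_ne_zero _ (by simp))
  choose u hu1 huc hu using fun m => hcurl.exists_lintegral_sub_gradient_le hd hF (hε m)
  have hgi : ∀ m, Integrable (gradient (u m)) := fun m => integrable_gradient (hu1 m) (huc m)
  set w : ℕ → EuclideanSpace ℝ (Fin d) → ℝ := fun m =>
    Nat.casesOn m (u 0) fun k x => u (k + 1) x - u k x with hw
  have hw1 : ∀ m, ContDiff ℝ 1 (w m) := fun m => by
    cases m with
    | zero => exact hu1 0
    | succ m => exact (hu1 (m + 1)).sub (hu1 m)
  have hwc : ∀ m, HasCompactSupport (w m) := fun m => by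
    cases m with
    | zero => exact huc 0
    | succ m => exact (huc (m + 1)).sub (huc m)
  have hgw : ∀ m x, gradient (w (m + 1)) x = gradient (u (m + 1)) x - gradient (u m) x := by
    intro m x
    have h1 := ((hu1 (m + 1)).differentiable (by simp) x).hasGradientAt
    have h2 := ((hu1 m).differentiable (by simp) x).hasGradientAt
    refine HasGradientAt.gradient ?_
    rw [hasGradientAt_iff_hasFDerivAt] at *
    refine (h1.sub h2).congr_fderiv ?_
    rw [map_sub]
  have hwle : ∀ m, ∫⁻ x, ‖gradient (w m) x‖ₑ ≤ 3 * (N₀ * (2⁻¹ : ℝ≥0∞) ^ m) := by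
    intro m
    cases m with
    | zero =>
      calc ∫⁻ x, ‖gradient (u 0) x‖ₑ ≤ ∫⁻ x, (‖F x‖ₑ + ‖F x - gradient (u 0) x‖ₑ) := by
            refine lintegral_mono fun x => ?_
            calc ‖gradient (u 0) x‖ₑ = ‖F x - (F x - gradient (u 0) x)‖ₑ := by simp
              _ ≤ _ := enorm_sub_le
        _ = N₀ + ∫⁻ x, ‖F x - gradient (u 0) x‖ₑ := by rw [lintegral_add_left' hF.1.enorm]
        _ ≤ N₀ + N₀ * (2⁻¹ : ℝ≥0∞) ^ 0 := by gcongr; exact hu 0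
        _ = 2 * (N₀ * (2⁻¹ : ℝ≥0∞) ^ 0) := by rw [pow_zero, mul_one, two_mul]
        _ ≤ _ := by gcongr; norm_num
    | succ m =>
      have hhalf : N₀ * (2⁻¹ : ℝ≥0∞) ^ m = 2 * (N₀ * (2⁻¹ : ℝ≥0∞) ^ (m + 1)) := by
        rw [pow_succ]
        calc N₀ * 2⁻¹ ^ m = N₀ * 2⁻¹ ^ m * (2 * 2⁻¹) := by
              rw [ENNReal.mul_inv_cancel (by simp) (by simp), mul_one]
          _ = _ := by ring
      calc ∫⁻ x, ‖gradient (w (m + 1)) x‖ₑ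
          ≤ ∫⁻ x, (‖F x - gradient (u m) x‖ₑ + ‖F x - gradient (u (m + 1)) x‖ₑ) := by
            refine lintegral_mono fun x => ?_
            calc ‖gradient (w (m + 1)) x‖ₑ =
                ‖(F x - gradient (u m) x) - (F x - gradient (u (m + 1)) x)‖ₑ := by
                  rw [hgw]; congr 1; abel
              _ ≤ _ := enorm_sub_le
        _ = (∫⁻ x, ‖F x - gradient (u m) x‖ₑ) + ∫⁻ x, ‖F x - gradient (u (m + 1)) x‖ₑ :=
            lintegral_add_left' (hF.sub (hgi m)).1.enorm _
        _ ≤ N₀ * (2⁻¹ : ℝ≥0∞) ^ m + N₀ * (2⁻¹ : ℝ≥0∞) ^ (m + 1) := add_le_add (hu _) (hu _)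
        _ = _ := by rw [hhalf]; ring
  have hgeo : ∑' m : ℕ, N₀ * (2⁻¹ : ℝ≥0∞) ^ m = N₀ * 2 := by
    rw [ENNReal.tsum_mul_left, ENNReal.tsum_geometric, ENNReal.one_sub_inv_two, inv_inv]
  have hbound : ∀ᵐ x, ‖kernelConv K F x‖ₑ ≤ ∑' m, ‖kernelConv K (gradient (w m)) x‖ₑ := by
    -- The errors are summable in `L¹`, so the single function `φ` is integrable and has an almost
    -- everywhere finite Riesz potential. At such points the potentials of all the errors form a
    -- convergent series and hence tend to zero; no subsequence is needed.
    set φ : EuclideanSpace ℝ (Fin d) → ℝ≥0∞ := fun y => ∑' m, ‖F y - gradient (u m) y‖ₑ with hφ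
    have hmm : ∀ m, AEMeasurable fun y => ‖F y - gradient (u m) y‖ₑ := fun m =>
      (hF.sub (hgi m)).1.enorm
    have hφm : AEMeasurable φ := AEMeasurable.tsum hmm
    have hφi : ∫⁻ y, φ y ≠ ⊤ := by
      rw [hφ, lintegral_tsum hmm]
      refine ne_top_of_le_ne_top ?_ (ENNReal.tsum_le_tsum hu)
      rw [hgeo]
      exact ENNReal.mul_ne_top hN₀top (by simp)
    filter_upwards [ae_lintegral_rpow_mul_lt_top (β := d - α) (by linarith)
      (by rw [hfin]; linarith) hφm hφi, hint hF, ae_all_iff.2 fun m => hint (hgi m)]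
      with x hx hxF hxg
    have hsub : ∀ m, kernelConv K F x - kernelConv K (gradient (u m)) x =
        ∫ y, K (x - y) • (F y - gradient (u m) y) := by
      intro m
      simp_rw [smul_sub]
      rw [integral_sub hxF (hxg m)]; rfl
    have hlim : Tendsto (fun m => ‖kernelConv K F x - kernelConv K (gradient (u m)) x‖ₑ) atTop
        (𝓝 0) := by
      have hsum : ∑' m, ∫⁻ y, ENNReal.ofReal (K (x - y)) * ‖F y - gradient (u m) y‖ₑ ≠ ⊤ := by
        have hKm : Measurable fun y => ENNReal.ofReal (K (x - y)) := by rw [hK]; fun_prop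
        have hm : ∀ m, AEMeasurable fun y =>
            ENNReal.ofReal (K (x - y)) * ‖F y - gradient (u m) y‖ₑ := fun m =>
          hKm.aemeasurable.mul (hmm m)
        rw [← lintegral_tsum hm]
        simp_rw [ENNReal.tsum_mul_left]
        exact hx.ne
      refine tendsto_of_tendsto_of_tendsto_of_le_of_le tendsto_const_nhds
        (ENNReal.tendsto_atTop_zero_of_tsum_ne_top hsum) (fun m => zero_le) fun m => ?_
      dsimp only
      rw [hsub]
      refine (enorm_integral_le_lintegral_enorm _).trans (lintegral_mono fun y => ?_)
      rw [enorm_smul, Real.enorm_of_nonneg (by rw [hK]; positivity)]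
    have htel : ∀ m, kernelConv K (gradient (u m)) x =
        ∑ k ∈ Finset.range (m + 1), kernelConv K (gradient (w k)) x := by
      intro m
      induction m with
      | zero => simp [hw]
      | succ m ih =>
        rw [Finset.sum_range_succ, ← ih]
        have : kernelConv K (gradient (w (m + 1))) x =
            kernelConv K (gradient (u (m + 1))) x - kernelConv K (gradient (u m)) x := by
          simp only [kernelConv]
          simp_rw [hgw, smul_sub]
          exact integral_sub (hxg (m + 1)) (hxg m)
        rw [this]; abel
    have hle : ∀ m, ‖kernelConv K F x‖ₑ ≤
        ‖kernelConv K F x - kernelConv K (gradient (u m)) x‖ₑ +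
          ∑' m, ‖kernelConv K (gradient (w m)) x‖ₑ := by
      intro m
      calc ‖kernelConv K F x‖ₑ = ‖(kernelConv K F x - kernelConv K (gradient (u m)) x) +
            kernelConv K (gradient (u m)) x‖ₑ := by simp
        _ ≤ _ := enorm_add_le _ _
        _ ≤ _ := by
            gcongr
            rw [htel]
            exact (enorm_sum_le _ _).trans (ENNReal.sum_le_tsum _)
    have := ge_of_tendsto' (hlim.add_const (∑' m, ‖kernelConv K (gradient (w m)) x‖ₑ)) hle
    simpa using this
  have hres := AtomicBound.tsum (fun m => hgrad (w m) (hw1 m) (hwc m)) hbound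
  refine hres.mono ?_
  calc ∑' m, ENNReal.ofReal C * ∫⁻ x, ‖gradient (w m) x‖ₑ
      ≤ ∑' m : ℕ, ENNReal.ofReal C * (3 * (N₀ * (2⁻¹ : ℝ≥0∞) ^ m)) := by
        gcongr with m
        exact hwle m
    _ = ENNReal.ofReal (C * 6) * N₀ := by
        rw [ENNReal.tsum_mul_left, ENNReal.tsum_mul_left, hgeo, ENNReal.ofReal_mul hC.le,
          show ENNReal.ofReal 6 = 3 * 2 by norm_num]
        ring

theorem rieszConst_pos {α : ℝ} (hα₀ : 0 < α) (hαd : α < d) : 0 < rieszConst d α := by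
  have h1 := Real.Gamma_pos_of_pos (show 0 < α / 2 by positivity)
  have h2 := Real.Gamma_pos_of_pos (show 0 < ((d : ℝ) - α) / 2 by linarith)
  unfold rieszConst
  have := Real.pi_pos
  positivity

/-- Both sizes of every atom scale by `c`, and `c^{1-μ} c^μ = c`. -/
theorem AtomicBound.const_smul {Ω : Type*} [MeasureSpace Ω] {G : Type*} [NormedAddCommGroup G]
    [NormedSpace ℝ G] {μ : ℝ} {f g : Ω → G} {M : ℝ≥0∞} (h : AtomicBound μ f M) {c : ℝ} (hc : 0 < c)
    (hg : ∀ᵐ x, g x = c • f x) : AtomicBound μ g (ENNReal.ofReal c * M) := by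
  obtain ⟨ι, hι, a, A, B, h1, h2, h3, h4, h5, h6, h7⟩ := h
  refine ⟨ι, hι, fun i x => ENNReal.ofReal c * a i x, fun i => c * A i, fun i => c * B i,
    fun i => (h1 i).const_mul _, fun i => mul_pos hc (h2 i), fun i => mul_pos hc (h3 i),
    fun i => ?_, fun i => ?_, ?_, ?_⟩
  · rw [lintegral_const_mul'' _ (h1 i), ENNReal.ofReal_mul hc.le]
    gcongr
    exact h4 i
  · filter_upwards [h5 i] with x hx
    rw [ENNReal.ofReal_mul hc.le]
    gcongr
  · filter_upwards [hg, h6] with x hx hx'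
    rw [hx, enorm_smul, Real.enorm_of_nonneg hc.le, ENNReal.tsum_mul_left]
    gcongr
  · have : ∀ i, (c * A i) ^ (1 - μ) * (c * B i) ^ μ = c * (A i ^ (1 - μ) * B i ^ μ) := by
      intro i
      rw [Real.mul_rpow hc.le (h2 i).le, Real.mul_rpow hc.le (h3 i).le]
      have e : c ^ (1 - μ) * c ^ μ = c := by rw [← Real.rpow_add hc]; simp
      calc _ = (c ^ (1 - μ) * c ^ μ) * (A i ^ (1 - μ) * B i ^ μ) := by ring
        _ = _ := by rw [e]
    simp_rw [this, ENNReal.ofReal_mul hc.le]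
    rw [ENNReal.tsum_mul_left]
    gcongr

end Main

theorem theorem1p1 (d : ℕ) (hd : 2 ≤ d) (α : ℝ) (hα₀ : 0 < α) (hαd : α < d) :
    ∃ C : ℝ, 0 < C ∧
      ∀ F : EuclideanSpace ℝ (Fin d) → EuclideanSpace ℝ (Fin d),
        MemLp F 1 volume → CurlFree F →
          (∀ᵐ x : EuclideanSpace ℝ (Fin d), ∀ i : Fin d,
            Integrable (rieszIntegrand α (fun y => F y i) x) volume) ∧
          MemLorentz ((d : ℝ) / (d - α)) 1 (rieszPotentialVec α F) ∧
          lorentzNorm ((d : ℝ) / (d - α)) 1 (rieszPotentialVec α F) ≤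
            ENNReal.ofReal C * eLpNorm F 1 volume := by
  obtain ⟨C, hC, hmain⟩ := exists_atomicBound_of_curlFree hd hα₀ hαd
  have hd0 : (0 : ℝ) < d := hα₀.trans hαd
  set μ : ℝ := α / d with hμ
  have hμ0 : 0 < μ := by positivity
  have hμ1 : μ < 1 := (div_lt_one hd0).2 hαd
  have hq : 1 / ((d : ℝ) / (d - α)) = 1 - μ := by
    rw [hμ]; field_simp
  have hγ := rieszConst_pos hα₀ hαd
  have hm1 : 0 < 1 - μ := by linarith
  -- The factors are the Lorentz norm of a normalized atom, the normalization of the potential, and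
  -- the constant of the atomic decomposition.
  refine ⟨(1 / (1 - μ) + 1 / μ) * (1 / rieszConst d α * C), by positivity, fun F hF hcurl => ?_⟩
  have hFi : Integrable F := memLp_one_iff_integrable.1 hF
  have hint := ae_integrable_rieszIntegrand hα₀ hαd hFi
  have hae : ∀ᵐ x, rieszPotentialVec α F x =
      (1 / rieszConst d α) • kernelConv (fun x => ‖x‖ ^ (-((d : ℝ) - α))) F x := by
    filter_upwards [hint] with x hx using rieszPotentialVec_eq hx
  have hK : AEStronglyMeasurable
      (fun x : EuclideanSpace ℝ (Fin d) => ‖x‖ ^ (-((d : ℝ) - α))) :=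
    (by fun_prop : Measurable fun x : EuclideanSpace ℝ (Fin d) =>
      ‖x‖ ^ (-((d : ℝ) - α))).aestronglyMeasurable
  have hmeas : AEStronglyMeasurable (rieszPotentialVec α F) volume :=
    ((aestronglyMeasurable_kernelConv hK hFi.1).const_smul (1 / rieszConst d α)).congr
      (hae.mono fun x hx => hx.symm)
  have hbound : lorentzNorm ((d : ℝ) / (d - α)) 1 (rieszPotentialVec α F) ≤
      ENNReal.ofReal ((1 / (1 - μ) + 1 / μ) * (1 / rieszConst d α * C)) * eLpNorm F 1 volume := by
    have h := ((hmain F hFi hcurl).const_smul (by positivity) hae).lorentzNorm_le hμ0 hμ1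
      hmeas.norm.aemeasurable hq
    rwa [← mul_assoc (ENNReal.ofReal (1 / rieszConst d α)), ← ENNReal.ofReal_mul (by positivity),
      ← mul_assoc, ← ENNReal.ofReal_mul (by positivity), ← eLpNorm_one_eq_lintegral_enorm] at h
  exact ⟨hint, ⟨hmeas, hbound.trans_lt (ENNReal.mul_lt_top ENNReal.ofReal_lt_top hF.2)⟩, hbound⟩
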